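/- Consider a typical multicast transmitter $x_0$ located at the origin $o$ of $\mathbb{R}^2$ which sends a message in $\tau_m\in\mathbb{N}$ time slots. Let $\lambda_m>0$ and assume high mobility: the multicast transmitter processes $\Phi_m(1),\dots,\Phi_m(\tau_m)$ of the different slots are independent homogeneous Poisson point processes on $\mathbb{R}^2$ of intensity $\lambda_m$. Let $\mathbb{P}^o$ denote the Palm probability, under which the processes of the different slots are independent and each follows the Palm distribution of such a process, with the typical transmitter at $o$; write $x_1(k),x_2(k),\dots$ for the other transmitters in slot $k$. In slot $k$ the link from transmitter $x_j$ to a receiver at $y$ has fading $F_{y,x_j}(k)\sim\mathrm{Exp}(1)$; the fading variables are independent over links and slots and independent of all positions. With noise power $\sigma^2\ge 0$, transmit power $P_m>0$, $\mathrm{SNR}^{-1}=\sigma^2/P_m$, and path loss $\ell(r)=Ar^\alpha$, $A>0$, $\alpha>2$, let $$\mathrm{SINR}_{y}(k)=\frac{F_{y,x_0}(k)/\ell(\|y\|)}{\mathrm{SNR}^{-1}+\sum_{j\ge 1}F_{y,x_j}(k)/\ell(\|x_j(k)-y\|)}$$ (with $1/\ell(0)=\infty$). A receiver at $y$ is covered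 if $\mathrm{SINR}_y(k)\ge T$ for some $k\in\{1,\dots,\tau_m\}$, where $T>0$ is a fixed threshold. Let $p(y)$ be the $\mathbb{P}^o$-probability that a receiver at $y$ is covered. The intended receivers of the typical transmitter form a point process, independent of the transmitters and of the fading, with intensity measure $\lambda_r\,\nu(\cdot\cap B(o,R))$, where $\nu$ is Lebesgue measure, $\lambda_r\ge 0$ and $R>0$ (nothing else is assumed on its distribution). Let $N$ be the number of covered intended receivers. Put $$K(\alpha,n)=\frac{2\pi}{\alpha}\int_0^\infty t^{-\frac2\alpha-1}\Bigl(1-\frac1{(1+t)^n}\Bigr)\,dt .$$ Then for every $y\in\mathbb{R}^2$ $$p(y)=\sum_{n=1}^{\tau_m}(-1)^{n+1}\binom{\tau_m}{n}e^{-nT\,\mathrm{SNR}^{-1}A\|y\|^\alpha}\,e^{-\lambda_m\,nK(\alpha,1)\,T^{2/\alpha}\|y\|^2},$$ and $N$ is integrable under $\mathbb{P}^o$ with $$\mathbb{E}^o[N]=2\pi\lambda_r\sum_{n=1}^{\tau_m}(-1)^{n+1}\binom{\tau_m}{n}\int_0^R r\,e^{-nT\,\mathrm{SNR}^{-1}Ar^\alpha}\,e^{-\lambda_m\,nK(\alpha,1)\,T^{2/\alpha}r^2}\,dr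 .$$ -/

import Mathlib

open MeasureTheory ProbabilityTheory
open scoped ENNReal

/-- The plane `ℝ²` with its Euclidean norm. -/
abbrev Plane : Type := EuclideanSpace ℝ (Fin 2)

/-- `Q`, a probability law on the space of measures on the plane, is the law of a Poisson point
process with intensity measure `ν`: the number of points in a measurable set of finite
`ν`-measure is Poisson distributed with mean the `ν`-measure of the set, and the numbers of points
in finitely many pairwise disjoint such sets are independent. -/
structure IsPoissonPointProcessLaw (Q : Measure (Measure Plane)) (ν : Measure Plane) : Prop where
  isProbabilityMeasure : IsProbabilityMeasure Q
  count_law : ∀ S : Set Plane, MeasurableSet S → ν S < ∞ →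
    Q.map (fun φ : Measure Plane => φ S) =
      (poissonMeasure (ν S).toNNReal).map (fun m : ℕ => (m : ℝ≥0∞))
  count_indep : ∀ (m : ℕ) (S : Fin m → Set Plane), (∀ a, MeasurableSet (S a)) →
    (∀ a, ν (S a) < ∞) → Pairwise (fun a b => Disjoint (S a) (S b)) →
    iIndepFun (fun (a : Fin m) (φ : Measure Plane) => φ (S a)) Q

/-- The configuration `φ` seen from the point `x`: all points are translated by `-x`. -/
noncomputable def seenFrom (x : Plane) (φ : Measure Plane) : Measure Plane :=
  φ.map (fun z => z - x)

/-- Under `P`, the random configuration `Φ` is distributed according to the Palm distribution of the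
stationary point process with law `Q` and intensity `lam`: for every bounded Borel set `B` and every
nonnegative measurable functional `G` of configurations,
`lam |B| E_P[G(Φ)] = E_Q[∫_B G(φ seen from x) φ(dx)]`. -/
def HasPalmLaw {Ω : Type*} [MeasurableSpace Ω] (P : Measure Ω) (Φ : Ω → Measure Plane)
    (Q : Measure (Measure Plane)) (lam : ℝ) : Prop :=
  ∀ B : Set Plane, MeasurableSet B → Bornology.IsBounded B →
    ∀ G : Measure Plane → ℝ≥0∞, Measurable G →
      ENNReal.ofReal lam * volume B * ∫⁻ ω, G (Φ ω) ∂P =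
        ∫⁻ φ, ∫⁻ x in B, G (seenFrom x φ) ∂φ ∂Q

/-- The point process `∑_j δ_{x_j}` of the points `x_j`, `j = 0, 1, 2, …`. -/
noncomputable def pointProcess {Ω : Type*} (x : ℕ → Ω → Plane) (ω : Ω) : Measure Plane :=
  Measure.sum (fun j => Measure.dirac (x j ω))

/-- The point process `∑_{i < M} δ_{y_i}` of a random number `M` of points. -/
noncomputable def finitePointProcess {Ω : Type*} (M : Ω → ℕ) (y : ℕ → Ω → Plane) (ω : Ω) :
    Measure Plane :=
  ∑ i ∈ Finset.range (M ω), Measure.dirac (y i ω)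

/-- The typical multicast cluster, with transmitter at the origin, under high mobility; `P` is the
Palm probability. `x k j` is the position of transmitter `j` in slot `k` (`j = 0` is the typical
transmitter), `M` is the number of intended receivers of the typical transmitter, `y i` for `i < M`
are their positions, and `F k i j` is the power fading in slot `k` of the link from transmitter `j`
to receiver `i`. -/
structure IsHighMobilityCluster {Ω : Type*} [MeasurableSpace Ω] (P : Measure Ω)
    (Q : Measure (Measure Plane)) (τ : ℕ) (lamM lamR R : ℝ)
    (x : Fin τ → ℕ → Ω → Plane) (M : Ω → ℕ) (y : ℕ → Ω → Plane)
    (F : Fin τ → ℕ → ℕ → Ω → ℝ) : Prop where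
  measurable_tx : ∀ k j, Measurable (x k j)
  measurable_rxCount : Measurable M
  measurable_rx : ∀ i, Measurable (y i)
  measurable_fading : ∀ k i j, Measurable (F k i j)
  /-- Transmitter `0` is the typical transmitter, at the origin. -/
  tx_zero : ∀ k, ∀ᵐ ω ∂P, x k 0 ω = 0
  /-- In each slot the transmitters follow the Palm distribution of the process with law `Q`. -/
  tx_palm : ∀ k, HasPalmLaw P (pointProcess (x k)) Q lamM
  /-- High mobility: the transmitter processes of different slots are independent. -/
  tx_indep : iIndepFun (fun k : Fin τ => pointProcess (x k)) P
  /-- The receiver process has intensity measure `lamR` times Lebesgue measure on `B(o, R)`;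
  nothing else is assumed on its distribution. -/
  rx_intensity : ∀ S : Set Plane, MeasurableSet S →
    ∫⁻ ω, finitePointProcess M y ω S ∂P = ENNReal.ofReal lamR * volume (S ∩ Metric.ball 0 R)
  /-- The receivers are an independent mark of the typical transmitter. -/
  rx_indep : IndepFun (fun ω => (M ω, fun i => y i ω))
    (fun ω => fun k : Fin τ => pointProcess (x k) ω) P
  /-- Rayleigh fading: the power fading coefficients are exponential with mean `1`, ... -/
  fading_law : ∀ k i j, P.map (F k i j) = expMeasure 1
  /-- ... independent over slots and links, ... -/
  fading_iIndep : iIndepFun (fun a : Fin τ × ℕ × ℕ => F a.1 a.2.1 a.2.2) P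
  /-- ... and independent of all positions. -/
  fading_indep : IndepFun (fun ω => fun a : Fin τ × ℕ × ℕ => F a.1 a.2.1 a.2.2 ω)
    (fun ω => ((fun k j => x k j ω : Fin τ → ℕ → Plane), (M ω, fun i => y i ω))) P

/-- The power path loss `ℓ(r) = A r^α`. -/
noncomputable def pathLoss (A α r : ℝ) : ℝ := A * r ^ α

/-- The SINR in one slot of the link from the typical transmitter, at the origin, to a receiver at
`y`. `x j`, `j ≥ 1`, are the positions of the interferers, `f j` is the power fading of the link
from transmitter `j` to this receiver, `ℓ` is the path loss and `snrInv` the inverse of the SNR.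
Values are taken in `[0, ∞]`, so that the infinite sum always has its true value and the path gain
`1 / ℓ` is `∞` where `ℓ` vanishes. -/
noncomputable def sinr (ℓ : ℝ → ℝ) (snrInv : ℝ) (x : ℕ → Plane) (f : ℕ → ℝ) (y : Plane) : ℝ≥0∞ :=
  (ENNReal.ofReal (f 0) / ENNReal.ofReal (ℓ ‖y‖)) /
    (ENNReal.ofReal snrInv +
      ∑' j : ℕ, ENNReal.ofReal (f (j + 1)) / ENNReal.ofReal (ℓ ‖x (j + 1) - y‖))

/-- A receiver at `y` with fading coefficients `f k j` (slot `k`, transmitter `j`) is covered if its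
SINR reaches the threshold `T` in at least one of the `τ` slots. -/
def Covered (ℓ : ℝ → ℝ) (snrInv T : ℝ) {τ : ℕ} (x : Fin τ → ℕ → Plane) (f : Fin τ → ℕ → ℝ)
    (y : Plane) : Prop :=
  ∃ k : Fin τ, ENNReal.ofReal T ≤ sinr ℓ snrInv (x k) (f k) y

/-- The probability that receiver `i`, when located at the point `z`, is covered. -/
noncomputable def coverageProb {Ω : Type*} [MeasurableSpace Ω] (P : Measure Ω) (ℓ : ℝ → ℝ)
    (snrInv T : ℝ) {τ : ℕ} (x : Fin τ → ℕ → Ω → Plane) (F : Fin τ → ℕ → ℕ → Ω → ℝ)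
    (i : ℕ) (z : Plane) : ℝ :=
  P.real {ω | Covered ℓ snrInv T (fun k j => x k j ω) (fun k j => F k i j ω) z}

open Classical in
/-- The number of covered receivers of the typical cluster. -/
noncomputable def numCovered {Ω : Type*} (ℓ : ℝ → ℝ)
    (snrInv T : ℝ) {τ : ℕ} (x : Fin τ → ℕ → Ω → Plane) (M : Ω → ℕ) (y : ℕ → Ω → Plane)
    (F : Fin τ → ℕ → ℕ → Ω → ℝ) (ω : Ω) : ℕ :=
  ((Finset.range (M ω)).filter (fun i =>
    Covered ℓ snrInv T (fun k j => x k j ω) (fun k j => F k i j ω) (y i ω))).card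

/-- `K(α, n) = (2π/α) ∫_0^∞ t^{-2/α - 1} (1 - (1 + t)^{-n}) dt`. -/
noncomputable def K (α : ℝ) (n : ℕ) : ℝ :=
  2 * Real.pi / α * ∫ t in Set.Ioi (0 : ℝ), t ^ (-(2 / α) - 1) * (1 - 1 / (1 + t) ^ n)

/-! Fix a receiver at `z ≠ 0` and put `s = T ℓ(‖z‖)`. Coverage in one slot means `F₀ ≥ s (SNR⁻¹ +
I)` with `I` the interference. As `F₀` is exponential, this has conditional probability `exp(-s
SNR⁻¹) exp(-s I)`. Averaging over the other fadings replaces `exp(-s I)` by `∏ 1 / (1 + s / ℓ(‖x_j -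
z‖))`, which is the exponential of a negative sum over the points of the transmitter process
(`measure_add_tsum_fading_le`).

The expectation of that exponential is a Laplace functional of the Palm process. By Slivnyak's
theorem (`HasPalmLaw.lintegral_expNeg`) it is the atom at the origin times the Poisson functional
`exp(-λ ∫ s / (s + ℓ(‖u‖)) du)`. The atom is divided out, and the integral equals `K(α,1)
(s/A)^(2/α) = K(α,1) T^(2/α) ‖z‖²` (`integral_div_add_pathLoss`). So one slot succeeds with
probability `q(z)`. Given the transmitters the slots are independent, and under high mobility so are
their conditional success probabilities; hence `p = 1 - (1 - q)^τ`, and the binomial theorem gives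
the sum.

Slivnyak's theorem is proved from the definition of the Palm law on small balls `B`. Recentring at a
point of `B` moves distances by little, so for decreasing radial functions the functional is
squeezed between expressions in the number of points in `B` and the points outside `B`. These are
independent, and size-biasing the Poisson count produces the factor `ν B` that cancels.

For `E[N]`, the fading and then the transmitters are averaged with the receivers frozen, which
leaves `∑ p(y_i)`. Campbell's formula and polar coordinates finish. -/

/-! ### Exponential and logarithm on `[0, ∞]`. -/

section ExpNeg

/-- `t ↦ e^{-t}` on `[0, ∞]`, with `e^{-∞} = 0`. -/
noncomputable def expNeg (t : ℝ≥0∞) : ℝ≥0∞ := EReal.exp (-(t : EReal))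

lemma continuous_expNeg : Continuous expNeg :=
  ENNReal.continuous_exp.comp (continuous_neg.comp continuous_coe_ennreal_ereal)

@[fun_prop]
lemma measurable_expNeg : Measurable expNeg := continuous_expNeg.measurable

lemma antitone_expNeg : Antitone expNeg := fun a b hab => by
  simpa [expNeg] using hab

@[simp] lemma expNeg_zero : expNeg 0 = 1 := by simp [expNeg]

@[simp] lemma expNeg_top : expNeg ∞ = 0 := by simp [expNeg]

lemma expNeg_le_one (t : ℝ≥0∞) : expNeg t ≤ 1 := by
  simpa using antitone_expNeg (zero_le (a := t))

lemma expNeg_ne_top (t : ℝ≥0∞) : expNeg t ≠ ∞ := ((expNeg_le_one t).trans_lt ENNReal.one_lt_top).ne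

lemma expNeg_ne_zero {t : ℝ≥0∞} (ht : t ≠ ∞) : expNeg t ≠ 0 := by
  simp [expNeg, ht]

lemma expNeg_add (a b : ℝ≥0∞) : expNeg (a + b) = expNeg a * expNeg b := by
  unfold expNeg
  rw [← EReal.exp_add, EReal.coe_ennreal_add, EReal.neg_add, sub_eq_add_neg]
  · left; simp
  · right; simp

lemma expNeg_finsetSum {ι : Type*} (s : Finset ι) (a : ι → ℝ≥0∞) :
    expNeg (∑ i ∈ s, a i) = ∏ i ∈ s, expNeg (a i) := by
  classical
  induction s using Finset.induction_on with
  | empty => simp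
  | insert i s hi ih => rw [Finset.sum_insert hi, Finset.prod_insert hi, expNeg_add, ih]

lemma expNeg_mul_natCast (a : ℝ≥0∞) (n : ℕ) : expNeg (a * n) = expNeg a ^ n := by
  have := expNeg_finsetSum (Finset.range n) (fun _ => a)
  simpa [mul_comm] using this

lemma expNeg_ofReal {r : ℝ} (hr : 0 ≤ r) :
    expNeg (ENNReal.ofReal r) = ENNReal.ofReal (Real.exp (-r)) := by
  unfold expNeg
  rw [EReal.coe_ennreal_ofReal, max_eq_left hr, ← EReal.coe_neg, EReal.exp_coe]

/-- `log (1 + t)` on `[0, ∞]`. -/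
noncomputable def logOneAdd (t : ℝ≥0∞) : ℝ≥0∞ := (ENNReal.log (1 + t)).toENNReal

lemma continuous_logOneAdd : Continuous logOneAdd :=
  EReal.continuous_toENNReal.comp (ENNReal.continuous_log.comp (by fun_prop))

@[fun_prop]
lemma measurable_logOneAdd : Measurable logOneAdd := continuous_logOneAdd.measurable

lemma monotone_logOneAdd : Monotone logOneAdd := fun a b hab =>
  EReal.toENNReal_le_toENNReal (ENNReal.log_monotone (by gcongr))

lemma expNeg_logOneAdd (t : ℝ≥0∞) : expNeg (logOneAdd t) = (1 + t)⁻¹ := by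
  unfold expNeg logOneAdd
  rw [EReal.coe_toENNReal, EReal.exp_neg, ENNReal.exp_log]
  simp

lemma logOneAdd_ne_top {t : ℝ≥0∞} (ht : t ≠ ∞) : logOneAdd t ≠ ∞ := fun h => by
  have := expNeg_logOneAdd t
  rw [h, expNeg_top] at this
  exact ENNReal.inv_ne_zero.2 (by finiteness) this.symm

end ExpNeg

/-! ### Generating functions of the Poisson distribution. -/

section Poisson
open scoped NNReal

lemma lintegral_poissonMeasure (m : ℝ≥0) (f : ℕ → ℝ≥0∞) :
    ∫⁻ n, f n ∂(poissonMeasure m) =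
      ∑' n : ℕ, ENNReal.ofReal (Real.exp (-m) * m ^ n / n.factorial) * f n := by
  simp [poissonMeasure, lintegral_sum_measure]

lemma lintegral_pow_poissonMeasure (m : ℝ≥0) {q : ℝ≥0∞} (hq : q ≤ 1) :
    ∫⁻ n, q ^ n ∂(poissonMeasure m) = expNeg (m * (1 - q)) := by
  lift q to ℝ≥0 using (hq.trans_lt ENNReal.one_lt_top).ne
  have hq' : (q : ℝ) ≤ 1 := by exact_mod_cast hq
  have h1 : (m : ℝ≥0∞) * (1 - q) = ENNReal.ofReal (m * (1 - q)) := by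
    rw [ENNReal.ofReal_mul m.coe_nonneg, ENNReal.ofReal_sub _ q.coe_nonneg]; simp
  rw [h1, expNeg_ofReal (mul_nonneg m.coe_nonneg (by linarith)), lintegral_poissonMeasure]
  have h2 : HasSum (fun n : ℕ => Real.exp (-m) * m ^ n / n.factorial * (q : ℝ) ^ n)
      (Real.exp (-(m * (1 - q)))) := by
    convert! (NormedSpace.expSeries_div_hasSum_exp (m * q : ℝ)).mul_left (Real.exp (-m)) using 1
    · ext n; rw [mul_pow]; ring
    · rw [← Real.exp_eq_exp_ℝ, ← Real.exp_add]; congr 1; ring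
  rw [← h2.tsum_eq, ENNReal.ofReal_tsum_of_nonneg (fun n => by positivity) h2.summable]
  congr with n
  rw [ENNReal.ofReal_mul (by positivity), ENNReal.ofReal_pow q.coe_nonneg]; simp

/-- Size-biasing: `n mⁿ / n! = m · mⁿ⁻¹ / (n-1)!`, so weighting by the count shifts the Poisson law
by one point. This is the source of the extra atom in Slivnyak's theorem. -/
lemma lintegral_natCast_mul_pow_poissonMeasure (m : ℝ≥0) {q : ℝ≥0∞} (hq : q ≤ 1) :
    ∫⁻ n, (n : ℝ≥0∞) * q ^ n ∂(poissonMeasure m) = m * q * expNeg (m * (1 - q)) := by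
  rw [← lintegral_pow_poissonMeasure m hq, lintegral_poissonMeasure, lintegral_poissonMeasure,
    tsum_eq_zero_add' ENNReal.summable, ← ENNReal.tsum_mul_left]
  simp only [Nat.cast_zero, zero_mul, mul_zero, zero_add]
  congr with n
  have : Real.exp (-m) * m ^ (n + 1) / (n + 1).factorial * (n + 1) =
      m * (Real.exp (-m) * m ^ n / n.factorial) := by
    rw [Nat.factorial_succ]; push_cast; field_simp; ring
  have h3 := congrArg ENNReal.ofReal this
  rw [ENNReal.ofReal_mul (by positivity), ENNReal.ofReal_mul m.coe_nonneg, ENNReal.ofReal_coe_nnreal,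
    ENNReal.ofReal_add (by positivity) zero_le_one, ENNReal.ofReal_natCast, ENNReal.ofReal_one] at h3
  push_cast
  rw [← mul_assoc, h3, pow_succ]; ring

end Poisson

/-! ### Laplace functional of a Poisson process. -/

section PoissonProcess
open scoped NNReal
open Filter Topology

variable {Q : Measure (Measure Plane)} {ν : Measure Plane}

lemma IsPoissonPointProcessLaw.lintegral_count (hQ : IsPoissonPointProcessLaw Q ν)
    {S : Set Plane} (hS : MeasurableSet S) (hνS : ν S < ∞) {f : ℝ≥0∞ → ℝ≥0∞} (hf : Measurable f) :
    ∫⁻ φ, f (φ S) ∂Q = ∫⁻ n : ℕ, f n ∂(poissonMeasure (ν S).toNNReal) := by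
  rw [← lintegral_map (f := f) (g := fun φ : Measure Plane => φ S) hf (Measure.measurable_coe hS),
    hQ.count_law S hS hνS, lintegral_map hf .of_discrete]

lemma IsPoissonPointProcessLaw.lintegral_prod_count (hQ : IsPoissonPointProcessLaw Q ν)
    {ι : Type*} [Fintype ι] (S : ι → Set Plane) (hS : ∀ i, MeasurableSet (S i))
    (hνS : ∀ i, ν (S i) < ∞) (hd : Pairwise fun i j => Disjoint (S i) (S j))
    (f : ι → ℝ≥0∞ → ℝ≥0∞) (hf : ∀ i, Measurable (f i)) :
    ∫⁻ φ, ∏ i, f i (φ (S i)) ∂Q =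
      ∏ i, ∫⁻ n : ℕ, f i n ∂(poissonMeasure (ν (S i)).toNNReal) := by
  have h1 : iIndepFun (fun (i : ι) (φ : Measure Plane) => φ (S i)) Q := by
    let e := Fintype.equivFin ι
    have := hQ.count_indep (Fintype.card ι) (fun a => S (e.symm a)) (fun a => hS _)
      (fun a => hνS _) (fun a b hab => hd (fun h => hab (e.symm.injective h)))
    simpa using this.precomp e.injective
  have h2 := h1.comp f hf
  refine (lintegral_prod_eq_prod_lintegral_of_indepFun Finset.univ _ h2
    (fun i => (hf i).comp (Measure.measurable_coe (hS i)))).trans ?_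
  exact Finset.prod_congr rfl fun i _ => hQ.lintegral_count (hS i) (hνS i) (hf i)

/-- For simple `g` the integral is a finite combination of counts on the level sets of `g` in `K`.
These are disjoint from each other and from `B`, so independence factors the expectation, and each
level `v` contributes the generating function at `e^{-v}`. -/
lemma IsPoissonPointProcessLaw.lintegral_count_mul_expNeg_simpleFunc
    (hQ : IsPoissonPointProcessLaw Q ν) {B K : Set Plane} (hB : MeasurableSet B) (hνB : ν B < ∞)
    (hK : MeasurableSet K) (hνK : ν K < ∞) (hBK : Disjoint B K) {f : ℝ≥0∞ → ℝ≥0∞}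
    (hf : Measurable f) (g : SimpleFunc Plane ℝ≥0∞) :
    ∫⁻ φ, f (φ B) * expNeg (∫⁻ u in K, g u ∂φ) ∂Q =
      (∫⁻ n : ℕ, f n ∂(poissonMeasure (ν B).toNNReal)) *
        expNeg (∫⁻ u in K, (1 - expNeg (g u)) ∂ν) := by
  classical
  have hint : ∀ φ : Measure Plane, ∫⁻ u in K, g u ∂φ =
      ∑ v : g.range, (v : ℝ≥0∞) * φ (g ⁻¹' {(v : ℝ≥0∞)} ∩ K) := by
    intro φ
    rw [SimpleFunc.lintegral_eq_lintegral, SimpleFunc.lintegral_restrict,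
      ← Finset.sum_coe_sort]
  have hint' : ∫⁻ u in K, (1 - expNeg (g u)) ∂ν =
      ∑ v : g.range, (1 - expNeg (v : ℝ≥0∞)) * ν (g ⁻¹' {(v : ℝ≥0∞)} ∩ K) := by
    have : ∀ u, 1 - expNeg (g u) = (g.map fun t => 1 - expNeg t) u := fun u => rfl
    simp_rw [this]
    rw [SimpleFunc.lintegral_eq_lintegral, SimpleFunc.map_lintegral, ← Finset.sum_coe_sort]
    refine Finset.sum_congr rfl fun v _ => ?_
    rw [Measure.restrict_apply (g.measurableSet_fiber _)]
  -- The index `none` stands for `B`, and `some v` for the level set of `v`.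
  let S : Option g.range → Set Plane := fun o => o.elim B fun v => g ⁻¹' {(v : ℝ≥0∞)} ∩ K
  let F : Option g.range → ℝ≥0∞ → ℝ≥0∞ := fun o => o.elim f fun v t => expNeg ((v : ℝ≥0∞) * t)
  have hsub : ∀ v, ν (g ⁻¹' {v} ∩ K) < ∞ := fun v =>
    (measure_mono Set.inter_subset_right).trans_lt hνK
  have key := hQ.lintegral_prod_count S
    (by rintro (_ | v)
        · exact hB
        · exact (g.measurableSet_fiber _).inter hK)
    (by rintro (_ | v)
        · exact hνB
        · exact hsub _)
    (by rintro (_ | v) (_ | w) hvw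
        · exact absurd rfl hvw
        · exact hBK.mono_right Set.inter_subset_right
        · exact (hBK.mono_right Set.inter_subset_right).symm
        · refine Set.disjoint_left.2 fun u hu hu' => hvw ?_
          have h1 : g u = v := hu.1
          have h2 : g u = w := hu'.1
          exact congrArg some (Subtype.ext (h1.symm.trans h2)))
    F
    (by rintro (_ | v)
        · exact hf
        · exact measurable_expNeg.comp (measurable_const_mul _))
  simp only [Fintype.prod_option, S, F, Option.elim] at key
  simp_rw [hint, expNeg_finsetSum, key, hint', expNeg_finsetSum]
  congr 1
  refine Finset.prod_congr rfl fun v _ => ?_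
  simp_rw [expNeg_mul_natCast]
  rw [lintegral_pow_poissonMeasure _ (expNeg_le_one _), ENNReal.coe_toNNReal (hsub _).ne, mul_comm]

/-- The joint law of the number of points in `B` and of the Laplace functional of the points
outside `B`. -/
lemma IsPoissonPointProcessLaw.lintegral_count_mul_expNeg (hQ : IsPoissonPointProcessLaw Q ν)
    [IsLocallyFiniteMeasure ν] {B : Set Plane} (hB : MeasurableSet B) (hνB : ν B < ∞)
    {f : ℝ≥0∞ → ℝ≥0∞} (hf : Measurable f)
    (hfin : ∫⁻ n : ℕ, f n ∂(poissonMeasure (ν B).toNNReal) ≠ ∞)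
    {g : Plane → ℝ≥0∞} (hg : Measurable g) :
    ∫⁻ φ, f (φ B) * expNeg (∫⁻ u in Bᶜ, g u ∂φ) ∂Q =
      (∫⁻ n : ℕ, f n ∂(poissonMeasure (ν B).toNNReal)) *
        expNeg (∫⁻ u in Bᶜ, (1 - expNeg (g u)) ∂ν) := by
  -- Bounded sets exhausting `Bᶜ`: counts are controlled only on sets of finite `ν`-measure.
  let K : ℕ → Set Plane := fun n => Metric.ball 0 n \ B
  have hK : ∀ n, MeasurableSet (K n) := fun n => measurableSet_ball.diff hB
  -- Monotone convergence in integrand and domain at once. It is used with `c = id` under `φ` and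
  -- with `c = 1 - e^{-·}` under `ν`.
  have hlim : ∀ (φ : Measure Plane) (c : ℝ≥0∞ → ℝ≥0∞), Continuous c → Monotone c →
      Tendsto (fun n => ∫⁻ u in K n, c (SimpleFunc.eapprox g n u) ∂φ) atTop
        (𝓝 (∫⁻ u in Bᶜ, c (g u) ∂φ)) := by
    intro φ c hc hcm
    simp_rw [← lintegral_indicator (hK _), ← lintegral_indicator hB.compl]
    refine lintegral_tendsto_of_tendsto_of_monotone
      (fun n => ((hc.measurable.comp (SimpleFunc.measurable _)).indicator (hK n)).aemeasurable)
      (ae_of_all _ fun u => ?_) (ae_of_all _ fun u => ?_)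
    · intro n m hnm
      refine (Set.indicator_le_indicator_of_subset ?_ (fun _ => zero_le) u).trans
        (Set.indicator_le_indicator (hcm (SimpleFunc.monotone_eapprox g hnm u)))
      exact Set.sdiff_subset_sdiff_left (Metric.ball_subset_ball (by exact_mod_cast hnm))
    · by_cases hu : u ∈ B
      · simp [K, hu]
      · rw [Set.indicator_of_mem (by exact hu)]
        have h1 : ∀ᶠ n : ℕ in atTop, u ∈ K n := by
          obtain ⟨n, hn⟩ := exists_nat_gt ‖u‖
          filter_upwards [eventually_ge_atTop n] with m hm
          refine ⟨?_, hu⟩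
          simpa using hn.trans_le (by exact_mod_cast hm)
        have h2 : Tendsto (fun n => c (SimpleFunc.eapprox g n u)) atTop (𝓝 (c (g u))) :=
          (hc.tendsto _).comp (SimpleFunc.tendsto_eapprox hg u)
        refine h2.congr' ?_
        filter_upwards [h1] with n hn
        rw [Set.indicator_of_mem hn]
  have hcont : Continuous fun t => 1 - expNeg t :=
    ENNReal.continuous_sub_left (by simp) |>.comp continuous_expNeg
  have hmono : Monotone fun t => 1 - expNeg t := fun a b hab =>
    tsub_le_tsub_left (antitone_expNeg hab) _
  have hν : ∀ n, ν (K n) < ∞ := fun n =>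
    (measure_mono Set.sdiff_subset).trans_lt Metric.isBounded_ball.measure_lt_top
  have hstep := fun n => hQ.lintegral_count_mul_expNeg_simpleFunc hB hνB (hK n) (hν n)
    Set.disjoint_sdiff_right hf (SimpleFunc.eapprox g n)
  have hR := ENNReal.Tendsto.const_mul (a := ∫⁻ n : ℕ, f n ∂(poissonMeasure (ν B).toNNReal))
    ((continuous_expNeg.tendsto _).comp (hlim ν _ hcont hmono)) (Or.inr hfin)
  have hL : Tendsto (fun n => ∫⁻ φ, f (φ B) *
      expNeg (∫⁻ u in K n, SimpleFunc.eapprox g n u ∂φ) ∂Q) atTop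
      (𝓝 (∫⁻ φ, f (φ B) * expNeg (∫⁻ u in Bᶜ, g u ∂φ) ∂Q)) := by
    have hfB : Measurable fun φ : Measure Plane => f (φ B) := hf.comp (Measure.measurable_coe hB)
    have hfB' : ∫⁻ φ : Measure Plane, f (φ B) ∂Q ≠ ∞ := by rwa [hQ.lintegral_count hB hνB hf]
    refine tendsto_lintegral_of_dominated_convergence (fun φ => f (φ B)) (fun n => ?_)
      (fun n => ae_of_all _ fun φ => ?_) hfB' ?_
    · refine hfB.mul (measurable_expNeg.comp ?_)
      simp_rw [← lintegral_indicator (hK _)]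
      exact Measure.measurable_lintegral ((SimpleFunc.measurable _).indicator (hK n))
    · exact mul_le_of_le_one_right' (expNeg_le_one _)
    · filter_upwards [ae_lt_top hfB hfB'] with φ hφ
      exact ENNReal.Tendsto.const_mul
        ((continuous_expNeg.tendsto _).comp (hlim φ id continuous_id monotone_id)) (Or.inr hφ.ne)
  exact tendsto_nhds_unique hL (by simpa only [hstep, Function.comp_def] using hR)

lemma IsPoissonPointProcessLaw.ae_lt_top (hQ : IsPoissonPointProcessLaw Q ν)
    {S : Set Plane} (hS : MeasurableSet S) (hνS : ν S < ∞) : ∀ᵐ φ ∂Q, φ S < ∞ := by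
  have hm : Measurable fun φ : Measure Plane => φ S := Measure.measurable_coe hS
  refine MeasureTheory.ae_lt_top hm ?_
  have := hQ.lintegral_count hS hνS measurable_id
  have h2 := lintegral_natCast_mul_pow_poissonMeasure (ν S).toNNReal (le_refl 1)
  simp only [id, one_pow, mul_one] at this h2
  rw [this, h2]
  simp

end PoissonProcess

/-! ### Slivnyak's theorem from the definition of the Palm law. -/

section Palm
open Filter Topology

variable {Q : Measure (Measure Plane)} {lam : ℝ}

lemma lintegral_seenFrom (x : Plane) (φ : Measure Plane) {f : Plane → ℝ≥0∞} (hf : Measurable f) :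
    ∫⁻ u, f u ∂(seenFrom x φ) = ∫⁻ u, f (u - x) ∂φ :=
  lintegral_map hf (measurable_id.sub_const x)

/-- The case `f(t) = t e^{-at}`. The prefactor `ν B` is the one on the left of the Palm identity. -/
lemma IsPoissonPointProcessLaw.lintegral_count_mul_expNeg_count {ν : Measure Plane}
    (hQ : IsPoissonPointProcessLaw Q ν) [IsLocallyFiniteMeasure ν] {B : Set Plane}
    (hB : MeasurableSet B) (hνB : ν B < ∞) (a : ℝ≥0∞) {g : Plane → ℝ≥0∞} (hg : Measurable g) :
    ∫⁻ φ, φ B * expNeg (a * φ B + ∫⁻ u in Bᶜ, g u ∂φ) ∂Q =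
      ν B * (expNeg a * expNeg (ν B * (1 - expNeg a)) *
        expNeg (∫⁻ u in Bᶜ, (1 - expNeg (g u)) ∂ν)) := by
  have hp : ∫⁻ n : ℕ, (n : ℝ≥0∞) * expNeg (a * n) ∂(poissonMeasure (ν B).toNNReal) =
      ν B * expNeg a * expNeg (ν B * (1 - expNeg a)) := by
    simp_rw [expNeg_mul_natCast]
    rw [lintegral_natCast_mul_pow_poissonMeasure _ (expNeg_le_one a),
      ENNReal.coe_toNNReal hνB.ne]
  have key := hQ.lintegral_count_mul_expNeg hB hνB (f := fun t => t * expNeg (a * t))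
    (by fun_prop) (by
      rw [hp]
      have := expNeg_ne_top a
      have := expNeg_ne_top (ν B * (1 - expNeg a))
      finiteness) hg
  simp_rw [expNeg_add, ← mul_assoc]
  rw [key, hp]

section Radial
variable {H : ℝ → ℝ≥0∞}

/-- For `x` in the ball, recentring at `x` increases the distance from an outer point to `z` by less
than `ε`, while points in the ball lie within `‖z‖ + 2ε` of `z`. Since `H` decreases, both
replacements only lower the exponent. -/
lemma lintegral_radial_le (hH : Antitone H) (hHm : Measurable H) (z : Plane) {ε : ℝ}
    (φ : Measure Plane) :
    ∫⁻ x in Metric.ball 0 ε, expNeg (∫⁻ u, H ‖u - z‖ ∂(seenFrom x φ)) ∂φ ≤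
      φ (Metric.ball 0 ε) * expNeg (H (‖z‖ + 2 * ε) * φ (Metric.ball 0 ε) +
        ∫⁻ u in (Metric.ball 0 ε)ᶜ, H (‖u - z‖ + ε) ∂φ) := by
  rw [mul_comm, ← setLIntegral_const]
  refine setLIntegral_mono' measurableSet_ball fun x hx => antitone_expNeg ?_
  rw [lintegral_seenFrom x φ (by fun_prop),
    ← lintegral_add_compl (μ := φ) (fun u => H ‖u - x - z‖)
      (measurableSet_ball (x := (0 : Plane)) (ε := ε)),
    ← setLIntegral_const]
  have hx' : ‖x‖ < ε := by simpa using hx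
  refine add_le_add (setLIntegral_mono' measurableSet_ball fun u hu => hH ?_)
    (setLIntegral_mono' measurableSet_ball.compl fun u _ => hH ?_)
  · have hu' : ‖u‖ < ε := by simpa using hu
    have h1 := norm_sub_le (u - x) z
    have h2 := norm_sub_le u x
    linarith
  · have h1 := norm_sub_le (u - z) x
    rw [sub_right_comm]
    linarith

/-- The mirror bound. The arguments of `H` may be negative here, so `H` has to be decreasing on all
of `ℝ`. -/
lemma le_lintegral_radial (hH : Antitone H) (hHm : Measurable H) (z : Plane) {ε : ℝ}
    (φ : Measure Plane) :
    φ (Metric.ball 0 ε) * expNeg (H (‖z‖ - 2 * ε) * φ (Metric.ball 0 ε) +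
        ∫⁻ u in (Metric.ball 0 ε)ᶜ, H (‖u - z‖ - ε) ∂φ) ≤
    ∫⁻ x in Metric.ball 0 ε, expNeg (∫⁻ u, H ‖u - z‖ ∂(seenFrom x φ)) ∂φ := by
  rw [mul_comm, ← setLIntegral_const]
  refine setLIntegral_mono' measurableSet_ball fun x hx => antitone_expNeg ?_
  rw [lintegral_seenFrom x φ (by fun_prop),
    ← lintegral_add_compl _ (measurableSet_ball (x := (0 : Plane)) (ε := ε)),
    ← setLIntegral_const]
  have hx' : ‖x‖ < ε := by simpa using hx
  refine add_le_add (setLIntegral_mono' measurableSet_ball fun u hu => hH ?_)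
    (setLIntegral_mono' measurableSet_ball.compl fun u _ => hH ?_)
  · have hu' : ‖u‖ < ε := by simpa using hu
    have h1 := norm_sub_norm_le z (u - x)
    have h2 := norm_sub_le u x
    rw [norm_sub_rev z] at h1
    linarith
  · have h1 := norm_sub_norm_le (u - z) x
    rw [sub_right_comm]
    linarith

/-- The sign `σ = ±1` covers both bounds. The middle factor tends to `1` because the balls shrink to
a `ν`-null point, and the last integral is dominated by the one with argument shifted by `-1`. -/
lemma tendsto_radial_bound (hH : Antitone H) (hHc : Continuous H)
    {ν : Measure Plane} [IsLocallyFiniteMeasure ν] (hν0 : ν {0} = 0) (z : Plane)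
    (hHi : ∫⁻ u, (1 - expNeg (H (‖u - z‖ - 1))) ∂ν ≠ ∞) {σ : ℝ} (hσ : |σ| ≤ 1) {ε : ℕ → ℝ}
    (hε0 : ∀ n, 0 ≤ ε n) (hε1 : ∀ n, ε n ≤ 1) (hε : Tendsto ε atTop (𝓝 0)) :
    Tendsto (fun n => expNeg (H (‖z‖ + σ * (2 * ε n))) *
        expNeg (ν (Metric.ball 0 (ε n)) * (1 - expNeg (H (‖z‖ + σ * (2 * ε n))))) *
        expNeg (∫⁻ u in (Metric.ball 0 (ε n))ᶜ, (1 - expNeg (H (‖u - z‖ + σ * ε n))) ∂ν)) atTop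
      (𝓝 (expNeg (H ‖z‖) * expNeg (∫⁻ u, (1 - expNeg (H ‖u - z‖)) ∂ν))) := by
  have hcont : Continuous fun t => 1 - expNeg t :=
    ENNReal.continuous_sub_left (by simp) |>.comp continuous_expNeg
  have hσε : ∀ (r c : ℝ), Tendsto (fun n => H (r + σ * (c * ε n))) atTop (𝓝 (H r)) := by
    intro r c
    refine (hHc.tendsto r).comp ?_
    simpa using tendsto_const_nhds.add ((hε.const_mul c).const_mul σ)
  have h1 : Tendsto (fun n => expNeg (H (‖z‖ + σ * (2 * ε n)))) atTop (𝓝 (expNeg (H ‖z‖))) :=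
    (continuous_expNeg.tendsto _).comp (hσε _ _)
  have hball : Tendsto (fun n => ν (Metric.ball 0 (ε n))) atTop (𝓝 0) := by
    have h1 : Tendsto (fun n => ν (Metric.cthickening (ε n) {0})) atTop (𝓝 (ν {0})) :=
      (tendsto_measure_cthickening_of_isClosed ⟨1, one_pos, by
        rw [Metric.cthickening_singleton _ zero_le_one]
        exact Metric.isBounded_closedBall.measure_lt_top.ne⟩ isClosed_singleton).comp hε
    rw [hν0] at h1
    refine tendsto_of_tendsto_of_tendsto_of_le_of_le tendsto_const_nhds h1 (fun n => zero_le)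
      fun n => measure_mono ?_
    rw [Metric.cthickening_singleton _ (hε0 n)]
    exact Metric.ball_subset_closedBall
  have h2 : Tendsto (fun n => expNeg (ν (Metric.ball 0 (ε n)) *
      (1 - expNeg (H (‖z‖ + σ * (2 * ε n)))))) atTop (𝓝 1) := by
    nth_rewrite 2 [← expNeg_zero]
    refine (continuous_expNeg.tendsto _).comp ?_
    exact tendsto_of_tendsto_of_tendsto_of_le_of_le tendsto_const_nhds hball (fun n => zero_le)
      fun n => mul_le_of_le_one_right' tsub_le_self
  have h3 : Tendsto (fun n => ∫⁻ u in (Metric.ball 0 (ε n))ᶜ,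
      (1 - expNeg (H (‖u - z‖ + σ * ε n))) ∂ν) atTop
      (𝓝 (∫⁻ u, (1 - expNeg (H ‖u - z‖)) ∂ν)) := by
    simp_rw [← lintegral_indicator (measurableSet_ball (α := Plane)).compl]
    refine tendsto_lintegral_of_dominated_convergence _ (fun n => ?_)
      (fun n => ae_of_all _ fun u => ?_) hHi ?_
    · exact (hcont.comp (hHc.comp (by fun_prop))).measurable.indicator measurableSet_ball.compl
    · refine (Set.indicator_le_self _ _ u).trans (tsub_le_tsub_left (antitone_expNeg (hH ?_)) _)
      have : |σ * ε n| ≤ 1 := by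
        rw [abs_mul, abs_of_nonneg (hε0 n)]
        exact mul_le_one₀ hσ (hε0 n) (hε1 n)
      linarith [(abs_le.1 this).1]
    · have : ∀ᵐ u ∂ν, u ≠ 0 := by
        rw [ae_iff]; simpa using hν0
      filter_upwards [this] with u hu
      have hu' : ∀ᶠ n in atTop, u ∈ (Metric.ball (0 : Plane) (ε n))ᶜ := by
        filter_upwards [hε.eventually_lt_const (norm_pos_iff.2 hu)] with n hn
        simpa using hn.le
      have := (hcont.tendsto _).comp (hσε ‖u - z‖ 1)
      refine this.congr' ?_
      filter_upwards [hu'] with n hn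
      rw [Set.indicator_of_mem hn]
      simp
  have h12 := ENNReal.Tendsto.mul h1 (Or.inr (by simp)) h2 (Or.inr (expNeg_ne_top _))
  rw [mul_one] at h12
  exact ENNReal.Tendsto.mul h12 (Or.inr (expNeg_ne_top _)) ((continuous_expNeg.tendsto _).comp h3)
    (Or.inr (expNeg_ne_top _))

/-- Slivnyak's theorem for the Laplace functional at radially decreasing functions. -/
theorem HasPalmLaw.lintegral_expNeg {Ω : Type*} [MeasurableSpace Ω] {P : Measure Ω}
    {Φ : Ω → Measure Plane} (hΦ : HasPalmLaw P Φ Q lam) (hlam : 0 < lam)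
    (hQ : IsPoissonPointProcessLaw Q (ENNReal.ofReal lam • (volume : Measure Plane)))
    (hH : Antitone H) (hHc : Continuous H)
    (hHi : ∫⁻ u : Plane, (1 - expNeg (H (‖u‖ - 1))) ≠ ∞) (z : Plane) :
    ∫⁻ ω, expNeg (∫⁻ u, H ‖u - z‖ ∂Φ ω) ∂P =
      expNeg (H ‖z‖) *
        expNeg (ENNReal.ofReal lam * ∫⁻ u : Plane, (1 - expNeg (H ‖u‖))) := by
  have hlam0 : ENNReal.ofReal lam ≠ 0 := by simpa using hlam
  set ν : Measure Plane := ENNReal.ofReal lam • (volume : Measure Plane) with hν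
  have : IsLocallyFiniteMeasure ν := by
    rw [hν, ← ENNReal.ofReal_toReal (ENNReal.ofReal_ne_top (r := lam)), ENNReal.ofReal]
    exact inferInstanceAs (IsLocallyFiniteMeasure
      ((ENNReal.ofReal lam).toReal.toNNReal • (volume : Measure Plane)))
  have hHm := hHc.measurable
  set ε : ℕ → ℝ := fun n => 1 / ((n : ℝ) + 1) with hε
  have hε0 : ∀ n, 0 < ε n := fun n => by positivity
  have hε1 : ∀ n, ε n ≤ 1 := fun n => by
    rw [hε]; exact div_le_one_of_le₀ (by linarith [n.cast_nonneg (α := ℝ)]) (by positivity)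
  have hεt : Tendsto ε atTop (𝓝 0) := tendsto_one_div_add_atTop_nhds_zero_nat
  have hHi' : ∫⁻ u, (1 - expNeg (H (‖u - z‖ - 1))) ∂ν ≠ ∞ := by
    rw [hν, lintegral_smul_measure,
      lintegral_sub_right_eq_self (fun u : Plane => 1 - expNeg (H (‖u‖ - 1))) z, smul_eq_mul]
    finiteness
  have hlim : ENNReal.ofReal lam * ∫⁻ u : Plane, (1 - expNeg (H ‖u‖)) =
      ∫⁻ u, (1 - expNeg (H ‖u - z‖)) ∂ν := by
    rw [hν, lintegral_smul_measure,
      lintegral_sub_right_eq_self (fun u : Plane => 1 - expNeg (H ‖u‖)) z, smul_eq_mul]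
  have hν0 : ν {0} = 0 := by simp [hν]
  have hBpos : ∀ n, ν (Metric.ball 0 (ε n)) ≠ 0 := fun n => by
    rw [hν, Measure.smul_apply, smul_eq_mul]
    exact mul_ne_zero hlam0 (Metric.measure_ball_pos _ _ (hε0 n)).ne'
  have hBfin : ∀ n, ν (Metric.ball 0 (ε n)) < ∞ := fun n => Metric.isBounded_ball.measure_lt_top
  have hpalm : ∀ n, ν (Metric.ball 0 (ε n)) * ∫⁻ ω, expNeg (∫⁻ u, H ‖u - z‖ ∂Φ ω) ∂P =
      ∫⁻ φ, ∫⁻ x in Metric.ball 0 (ε n), expNeg (∫⁻ u, H ‖u - z‖ ∂(seenFrom x φ)) ∂φ ∂Q := by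
    intro n
    rw [← hΦ _ measurableSet_ball Metric.isBounded_ball
      (fun φ => expNeg (∫⁻ u, H ‖u - z‖ ∂φ))
      (measurable_expNeg.comp (Measure.measurable_lintegral (by fun_prop)))]
    rfl
  rw [hlim]
  refine le_antisymm ?_ ?_
  -- After multiplication by the positive finite number `ν(ball)`, the Palm identity compares the
  -- two sides for every `n`.
  · refine ge_of_tendsto' (tendsto_radial_bound hH hHc hν0 z hHi' (σ := 1) (by simp)
      (fun n => (hε0 n).le) hε1 hεt) fun n => ?_
    rw [← ENNReal.mul_le_mul_iff_right (hBpos n) (hBfin n).ne, hpalm,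
      ← hQ.lintegral_count_mul_expNeg_count measurableSet_ball (hBfin n) _ (by fun_prop)]
    simp only [one_mul]
    exact lintegral_mono fun φ => lintegral_radial_le hH hHm z φ
  · refine le_of_tendsto' (tendsto_radial_bound hH hHc hν0 z hHi' (σ := -1) (by simp)
      (fun n => (hε0 n).le) hε1 hεt) fun n => ?_
    rw [← ENNReal.mul_le_mul_iff_right (hBpos n) (hBfin n).ne, hpalm,
      ← hQ.lintegral_count_mul_expNeg_count measurableSet_ball (hBfin n) _ (by fun_prop)]
    simp only [neg_mul, one_mul, ← sub_eq_add_neg]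
    exact lintegral_mono fun φ => le_lintegral_radial hH hHm z φ

/-- Bounded sets contain finitely many points of a Palm version of a Poisson process. -/
lemma HasPalmLaw.ae_lt_top {Ω : Type*} [MeasurableSpace Ω] {P : Measure Ω}
    {Φ : Ω → Measure Plane} (hΦ : HasPalmLaw P Φ Q lam) (hlam : 0 < lam) (hΦm : Measurable Φ)
    (hQ : IsPoissonPointProcessLaw Q (ENNReal.ofReal lam • (volume : Measure Plane))) (r : ℝ) :
    ∀ᵐ ω ∂P, Φ ω (Metric.ball 0 r) < ∞ := by
  have hm : ∀ s : ℝ, MeasurableSet {φ : Measure Plane | φ (Metric.ball 0 s) = ∞} := fun s =>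
    Measure.measurable_coe measurableSet_ball (measurableSet_singleton ∞)
  -- The Palm identity is tested on the event of infinite mass in the ball of radius `r`. Shifting
  -- by `‖x‖ < 1` stays within radius `r + 1`, where the Poisson process has finite mass almost
  -- surely.
  have h := hΦ (Metric.ball 0 1) measurableSet_ball Metric.isBounded_ball
    ({φ : Measure Plane | φ (Metric.ball 0 r) = ∞}.indicator 1) (measurable_one.indicator (hm r))
  have hz : ∫⁻ φ, ∫⁻ x in Metric.ball 0 1,
      ({φ : Measure Plane | φ (Metric.ball 0 r) = ∞}.indicator 1) (seenFrom x φ) ∂φ ∂Q = 0 := by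
    have hlt : (ENNReal.ofReal lam • (volume : Measure Plane)) (Metric.ball 0 (r + 1)) < ∞ := by
      rw [Measure.smul_apply, smul_eq_mul]
      have := measure_ball_lt_top (μ := (volume : Measure Plane)) (x := 0) (r := r + 1)
      finiteness
    rw [← lintegral_zero]
    refine lintegral_congr_ae ?_
    filter_upwards [hQ.ae_lt_top measurableSet_ball hlt] with φ hφ
    refine (setLIntegral_congr_fun measurableSet_ball fun x hx => ?_).trans
      (lintegral_zero (μ := φ.restrict (Metric.ball 0 1)))
    refine Set.indicator_of_notMem (fun hmem => hφ.ne (top_le_iff.1 ?_)) _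
    have hmem' : seenFrom x φ (Metric.ball 0 r) = ∞ := hmem
    rw [← hmem', seenFrom, Measure.map_apply (by fun_prop) measurableSet_ball]
    refine measure_mono fun u hu => ?_
    have h1 : ‖u - x‖ < r := by simpa using hu
    have h2 : ‖x‖ < 1 := by simpa using hx
    have h3 := norm_add_le (u - x) x
    rw [sub_add_cancel] at h3
    simpa using by linarith
  rw [hz, mul_eq_zero] at h
  have h0 : ENNReal.ofReal lam * volume (Metric.ball (0 : Plane) 1) ≠ 0 :=
    mul_ne_zero (by simpa using hlam) (Metric.measure_ball_pos _ _ one_pos).ne'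
  have h1 := h.resolve_left h0
  replace h1 := (lintegral_eq_zero_iff ((measurable_one.indicator (hm r)).comp hΦm)).1 h1
  filter_upwards [h1] with ω hω
  refine lt_top_iff_ne_top.2 fun htop => ?_
  have : Φ ω ∈ {φ : Measure Plane | φ (Metric.ball 0 r) = ∞} := htop
  simp [Set.indicator_of_mem this] at hω

end Radial
end Palm

/-! ### The path loss integral. -/

section PathLossIntegral
open Filter Topology

variable {A α s : ℝ}

/-- The logarithmic decrease, due to a transmitter at distance `r`, of the Laplace transform of the
interference at `s`. -/
noncomputable def logLaplace (A α s r : ℝ) : ℝ≥0∞ :=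
  logOneAdd (ENNReal.ofReal s / ENNReal.ofReal (pathLoss A α r))

lemma continuous_pathLoss (hα : 0 ≤ α) : Continuous (pathLoss A α) :=
  continuous_const.mul (Real.continuous_rpow_const hα)

lemma continuous_logLaplace (hα : 0 ≤ α) : Continuous (logLaplace A α s) := by
  refine continuous_logOneAdd.comp ?_
  simp_rw [div_eq_mul_inv]
  exact (ENNReal.continuous_const_mul ENNReal.ofReal_ne_top).comp
    (continuous_inv.comp (ENNReal.continuous_ofReal.comp (continuous_pathLoss hα)))

lemma logLaplace_anti (hA : 0 ≤ A) (hα : 0 ≤ α) {r r' : ℝ} (hr : 0 ≤ r) (h : r ≤ r') :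
    logLaplace A α s r' ≤ logLaplace A α s r := by
  refine monotone_logOneAdd (ENNReal.div_le_div_left (ENNReal.ofReal_le_ofReal ?_) _)
  exact mul_le_mul_of_nonneg_left (Real.rpow_le_rpow hr h hα) hA

lemma pathLoss_pos (hA : 0 < A) {r : ℝ} (hr : 0 < r) : 0 < pathLoss A α r :=
  mul_pos hA (Real.rpow_pos_of_pos hr _)

lemma pathLoss_zero (hα : α ≠ 0) : pathLoss A α 0 = 0 := by simp [pathLoss, Real.zero_rpow hα]

lemma pathLoss_nonneg (hA : 0 ≤ A) {r : ℝ} (hr : 0 ≤ r) : 0 ≤ pathLoss A α r :=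
  mul_nonneg hA (Real.rpow_nonneg hr _)

lemma logLaplace_ne_top (hA : 0 < A) {r : ℝ} (hr : 0 < r) : logLaplace A α s r ≠ ∞ :=
  logOneAdd_ne_top (ENNReal.div_ne_top ENNReal.ofReal_ne_top (by simpa using pathLoss_pos hA hr))

lemma one_sub_expNeg_logLaplace (hA : 0 < A) (hs : 0 < s) {r : ℝ} (hr : 0 ≤ r) :
    1 - expNeg (logLaplace A α s r) = ENNReal.ofReal (s / (s + pathLoss A α r)) := by
  rw [logLaplace, expNeg_logOneAdd]
  have hp := pathLoss_nonneg (α := α) hA.le hr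
  rcases hp.eq_or_lt with h | h
  · rw [← h, ENNReal.ofReal_zero, ENNReal.div_zero (by simpa using hs)]
    simp [hs.ne']
  · rw [← ENNReal.ofReal_div_of_pos h, ← ENNReal.ofReal_one,
      ← ENNReal.ofReal_add zero_le_one (by positivity), ← ENNReal.ofReal_inv_of_pos (by positivity),
      ← ENNReal.ofReal_sub _ (by positivity)]
    congr 1
    field_simp
    ring

lemma lintegral_one_add_norm_rpow_ne_top (hα : 2 < α) (C : ℝ) :
    ∫⁻ u : Plane, ENNReal.ofReal (C * (1 + ‖u‖) ^ (-α)) ≠ ∞ := by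
  have h : Integrable (fun u : Plane => C * (1 + ‖u‖) ^ (-α)) :=
    (integrable_one_add_norm (by simpa using hα)).const_mul C
  exact (h.lintegral_lt_top).ne

/-- Supplies the domination needed for Slivnyak's theorem with the path loss truncated near `0`. The
tail is `O(‖u‖^{-α})` with `α` above the dimension. -/
lemma lintegral_logLaplace_max_ne_top (hA : 0 < A) (hα : 2 < α) (hs : 0 < s) {c : ℝ} (hc : 0 < c) :
    ∫⁻ u : Plane, (1 - expNeg (logLaplace A α s (max (‖u‖ - 1) c))) ≠ ∞ := by
  -- The largest constant with `κ (1 + r) ≤ max (r - 1) c` for all `r ≥ 0`; equality holds at `r = 1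
  -- + c`.
  set κ := c / (2 + c) with hκ
  have hκ0 : 0 < κ := by positivity
  refine ne_top_of_le_ne_top
    (lintegral_one_add_norm_rpow_ne_top hα (s / (A * κ ^ α))) (lintegral_mono fun u => ?_)
  rw [one_sub_expNeg_logLaplace hA hs (hc.le.trans (le_max_right _ _))]
  refine ENNReal.ofReal_le_ofReal ?_
  have hu := norm_nonneg u
  have hle : κ * (1 + ‖u‖) ≤ max (‖u‖ - 1) c := by
    rw [hκ, div_mul_eq_mul_div, div_le_iff₀ (by positivity)]
    rcases le_total (‖u‖ - 1) c with h | h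
    · rw [max_eq_right h]; nlinarith
    · rw [max_eq_left h]; nlinarith
  have h1 : (κ * (1 + ‖u‖)) ^ α ≤ (max (‖u‖ - 1) c) ^ α :=
    Real.rpow_le_rpow (by positivity) hle (by linarith)
  rw [Real.mul_rpow hκ0.le (by positivity)] at h1
  rw [Real.rpow_neg (by positivity), ← div_eq_mul_inv, div_div]
  refine div_le_div_of_nonneg_left hs.le (by positivity) ?_
  have h2 : A * κ ^ α * (1 + ‖u‖) ^ α ≤ pathLoss A α (max (‖u‖ - 1) c) := by
    rw [pathLoss, mul_assoc]
    exact mul_le_mul_of_nonneg_left h1 hA.le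
  linarith

lemma integrable_div_add_pathLoss (hA : 0 < A) (hα : 2 < α) (hs : 0 < s) :
    Integrable (fun u : Plane => s / (s + pathLoss A α ‖u‖)) := by
  have hm : 0 < min s A := lt_min hs hA
  have h : Integrable (fun u : Plane => s * 2 ^ α / min s A * (1 + ‖u‖) ^ (-α)) :=
    (integrable_one_add_norm (by simpa using hα)).const_mul _
  have hp : ∀ u : Plane, 0 ≤ pathLoss A α ‖u‖ := fun u => pathLoss_nonneg hA.le (norm_nonneg u)
  refine h.mono' (Continuous.aestronglyMeasurable ?_) (ae_of_all _ fun u => ?_)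
  · have := (continuous_pathLoss (A := A) (α := α) (by linarith)).comp (continuous_norm (E := Plane))
    exact continuous_const.div (continuous_const.add this) fun u => by
      have := hp u; positivity
  · have hpu := hp u
    rw [Real.norm_of_nonneg (by positivity), Real.rpow_neg (by positivity), ← div_eq_mul_inv,
      div_div, div_le_div_iff₀ (by positivity) (by positivity), mul_assoc s (2 ^ α)]
    refine mul_le_mul_of_nonneg_left ?_ hs.le
    have h1 : (1 + ‖u‖) ^ α ≤ 2 ^ α * (1 + ‖u‖ ^ α) := by
      have h2 : (1 + ‖u‖) ≤ 2 * max 1 ‖u‖ := by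
        linarith [le_max_left 1 ‖u‖, le_max_right 1 ‖u‖]
      refine (Real.rpow_le_rpow (by positivity) h2 (by linarith)).trans ?_
      rw [Real.mul_rpow zero_le_two (by positivity)]
      gcongr
      have h3 := Real.rpow_nonneg (norm_nonneg u) α
      rcases le_total 1 ‖u‖ with h4 | h4
      · rw [max_eq_right h4]; linarith
      · rw [max_eq_left h4, Real.one_rpow]; linarith
    have h5 : min s A * (1 + ‖u‖ ^ α) ≤ s + pathLoss A α ‖u‖ := by
      rw [mul_add, mul_one, pathLoss]
      gcongr
      · exact min_le_left _ _
      · exact min_le_right _ _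
    calc min s A * (1 + ‖u‖) ^ α ≤ min s A * (2 ^ α * (1 + ‖u‖ ^ α)) := by gcongr
      _ = 2 ^ α * (min s A * (1 + ‖u‖ ^ α)) := by ring
      _ ≤ 2 ^ α * (s + pathLoss A α ‖u‖) := by gcongr

lemma integral_fun_norm_plane (f : ℝ → ℝ) :
    ∫ u : Plane, f ‖u‖ = 2 * Real.pi * ∫ r in Set.Ioi (0 : ℝ), r * f r := by
  rw [integral_fun_norm_addHaar (volume : Measure Plane) f, Measure.real,
    EuclideanSpace.volume_ball_fin_two]
  simp [mul_assoc, Real.pi_nonneg]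

/-- Polar coordinates and the substitution `t = (s/A) r^{-α}`, which turns `s / (s + A r^α)` into `1
- 1/(1 + t)`. It is done as a scaling followed by a power. -/
lemma integral_div_add_pathLoss (hA : 0 < A) (hα : 2 < α) (hs : 0 < s) :
    ∫ u : Plane, s / (s + pathLoss A α ‖u‖) = K α 1 * (s / A) ^ (2 / α) := by
  have hα0 : 0 < α := by linarith
  have hb : 0 < s / A := by positivity
  rw [integral_fun_norm_plane fun r => s / (s + pathLoss A α r)]
  set g : ℝ → ℝ := fun t => t ^ (-(2 / α) - 1) * (1 - 1 / (1 + t) ^ 1) with hg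
  have h1 : ∫ t in Set.Ioi (0 : ℝ), g t = s / A * ∫ t in Set.Ioi (0 : ℝ), g (s / A * t) := by
    rw [integral_comp_mul_left_Ioi g 0 hb, mul_zero, smul_eq_mul, mul_inv_cancel_left₀ hb.ne']
  have h2 := integral_comp_rpow_Ioi (fun t => g (s / A * t)) (p := -α) (by linarith)
  have h3 : ∫ x in Set.Ioi (0 : ℝ), (|-α| * x ^ (-α - 1)) • g (s / A * x ^ (-α)) =
      α * (s / A) ^ (-(2 / α) - 1) * ∫ r in Set.Ioi (0 : ℝ), r * (s / (s + pathLoss A α r)) := by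
    rw [← integral_const_mul]
    refine setIntegral_congr_fun measurableSet_Ioi fun r hr => ?_
    have hr : 0 < r := hr
    have e1 : (s / A * r ^ (-α)) ^ (-(2 / α) - 1) = (s / A) ^ (-(2 / α) - 1) * r ^ (2 + α) := by
      rw [Real.mul_rpow hb.le (by positivity), ← Real.rpow_mul hr.le]
      congr 2
      field_simp
      ring
    have e2 : r ^ (-α - 1) * r ^ (2 + α) = r := by
      rw [← Real.rpow_add hr]
      convert Real.rpow_one r using 2
      ring
    have e3 : 1 - 1 / (1 + s / A * r ^ (-α)) ^ 1 = s / (s + pathLoss A α r) := by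
      rw [Real.rpow_neg hr.le, pathLoss]
      have := Real.rpow_pos_of_pos hr α
      field_simp
      ring
    simp only [hg, smul_eq_mul, abs_neg, abs_of_pos hα0]
    rw [e1, e3]
    linear_combination (α * (s / A) ^ (-(2 / α) - 1) * (s / (s + pathLoss A α r))) * e2
  rw [K, h1, ← h2, h3]
  have e4 : s / A * (s / A) ^ (-(2 / α) - 1) * (s / A) ^ (2 / α) = 1 := by
    nth_rewrite 1 [← Real.rpow_one (s / A)]
    rw [← Real.rpow_add hb, ← Real.rpow_add hb]
    convert Real.rpow_zero (s / A) using 2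
    ring
  -- With the powers made opaque, `e4` is the only relation that the algebra needs.
  generalize ∫ r in Set.Ioi (0 : ℝ), r * (s / (s + pathLoss A α r)) = I
  generalize (s / A) ^ (-(2 / α) - 1) = c at e4 ⊢
  generalize (s / A) ^ (2 / α) = d at e4 ⊢
  generalize s / A = b at e4 ⊢
  field_simp
  linear_combination -I * e4

lemma lintegral_one_sub_expNeg_logLaplace (hA : 0 < A) (hα : 2 < α) (hs : 0 < s) :
    ∫⁻ u : Plane, (1 - expNeg (logLaplace A α s ‖u‖)) =
      ENNReal.ofReal (K α 1 * (s / A) ^ (2 / α)) := by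
  rw [← integral_div_add_pathLoss hA hα hs, ofReal_integral_eq_lintegral_ofReal
    (integrable_div_add_pathLoss hA hα hs) (ae_of_all _ fun u => ?_)]
  · exact lintegral_congr fun u => one_sub_expNeg_logLaplace hA hs (norm_nonneg u)
  · have := pathLoss_nonneg (α := α) hA.le (norm_nonneg u)
    simp only [Pi.zero_apply]
    positivity

lemma K_one_nonneg (hα : 0 < α) : 0 ≤ K α 1 := by
  refine mul_nonneg (by positivity) (setIntegral_nonneg measurableSet_Ioi fun t ht => ?_)
  have ht : 0 < t := ht
  have : 1 / (1 + t) ^ 1 ≤ 1 := by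
    rw [pow_one]; exact div_le_one_of_le₀ (by linarith) (by positivity)
  exact mul_nonneg (by positivity) (by linarith)

end PathLossIntegral

/-! ### Laplace transform of the interference. -/

section Interference
open Filter Topology

variable {Ω : Type*} [MeasurableSpace Ω]

lemma lintegral_pointProcess {Ω : Type*} (x : ℕ → Ω → Plane) (ω : Ω)
    {f : Plane → ℝ≥0∞} (hf : Measurable f) :
    ∫⁻ u, f u ∂(pointProcess x ω) = ∑' j, f (x j ω) := by
  rw [pointProcess, lintegral_sum_measure]
  exact tsum_congr fun j => lintegral_dirac' _ hf

lemma measurable_pointProcess {x : ℕ → Ω → Plane} (hx : ∀ j, Measurable (x j)) :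
    Measurable (pointProcess x) := by
  refine Measure.measurable_of_measurable_coe _ fun S hS => ?_
  simp_rw [pointProcess, Measure.sum_apply _ hS]
  exact Measurable.tsum fun j =>
    (Measure.measurable_coe hS).comp (Measure.measurable_dirac.comp (hx j))

lemma tendsto_max_one_div_add_one {r : ℝ} (hr : 0 ≤ r) :
    Tendsto (fun n : ℕ => max r (1 / ((n : ℝ) + 1))) atTop (𝓝 r) := by
  have := (tendsto_const_nhds (x := r)).max tendsto_one_div_add_atTop_nhds_zero_nat
  rwa [max_eq_left hr] at this

/-- Slivnyak's theorem also counts the typical transmitter, whose factor must be divided out.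
`logLaplace` is infinite at distance `0`, so distances are first truncated from below by `1/(n+1)`,
which also makes the function decreasing on all of `ℝ`; then `n → ∞`. -/
lemma lintegral_expNeg_tsum_logLaplace {P : Measure Ω} [IsProbabilityMeasure P]
    {Q : Measure (Measure Plane)} {lam A α s : ℝ} (hlam : 0 < lam) (hA : 0 < A) (hα : 2 < α)
    (hs : 0 < s)
    (hQ : IsPoissonPointProcessLaw Q (ENNReal.ofReal lam • (volume : Measure Plane)))
    {x : ℕ → Ω → Plane} (hx : ∀ j, Measurable (x j)) (hx0 : ∀ᵐ ω ∂P, x 0 ω = 0)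
    (hpalm : HasPalmLaw P (pointProcess x) Q lam) (z : Plane) :
    ∫⁻ ω, expNeg (∑' j, logLaplace A α s ‖x (j + 1) ω - z‖) ∂P =
      ENNReal.ofReal (Real.exp (-(lam * (K α 1 * (s / A) ^ (2 / α))))) := by
  have hα0 : 0 < α := by linarith
  set c : ℕ → ℝ := fun n => 1 / ((n : ℝ) + 1) with hc
  have hc0 : ∀ n, 0 < c n := fun n => by positivity
  have hcanti : Antitone c := fun m n hmn => Nat.one_div_le_one_div hmn
  set H : ℕ → ℝ → ℝ≥0∞ := fun n r => logLaplace A α s (max r (c n)) with hH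
  have hHanti : ∀ n, Antitone (H n) := fun n r r' hr =>
    logLaplace_anti hA.le hα0.le ((hc0 n).le.trans (le_max_right _ _)) (max_le_max_right _ hr)
  have hHcont : ∀ n, Continuous (H n) := fun n =>
    (continuous_logLaplace hα0.le).comp (continuous_id.max continuous_const)
  have hHmono : ∀ r, 0 ≤ r → Monotone fun n => H n r := fun r hr m n hmn =>
    logLaplace_anti hA.le hα0.le (hr.trans (le_max_left _ _)) (max_le_max_left _ (hcanti hmn))
  have hHlim : ∀ r, 0 ≤ r → Tendsto (fun n => H n r) atTop (𝓝 (logLaplace A α s r)) := fun r hr =>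
    ((continuous_logLaplace hα0.le).tendsto r).comp (tendsto_max_one_div_add_one hr)
  have hcontsub : Continuous fun t => 1 - expNeg t :=
    ENNReal.continuous_sub_left (by simp) |>.comp continuous_expNeg
  have hstep : ∀ n, ∫⁻ ω, expNeg (∑' j, H n ‖x (j + 1) ω - z‖) ∂P =
      expNeg (ENNReal.ofReal lam * ∫⁻ u : Plane, (1 - expNeg (H n ‖u‖))) := by
    intro n
    have h1 := hpalm.lintegral_expNeg hlam hQ (hHanti n) (hHcont n)
      (lintegral_logLaplace_max_ne_top hA hα hs (hc0 n)) z
    have h2 : ∀ᵐ ω ∂P, expNeg (∫⁻ u, H n ‖u - z‖ ∂(pointProcess x ω)) =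
        expNeg (H n ‖z‖) * expNeg (∑' j, H n ‖x (j + 1) ω - z‖) := by
      filter_upwards [hx0] with ω hω
      have hm := (hHcont n).measurable
      rw [lintegral_pointProcess x ω (f := fun u => H n ‖u - z‖) (by fun_prop),
        tsum_eq_zero_add' ENNReal.summable, expNeg_add, hω, zero_sub, norm_neg]
    rw [lintegral_congr_ae h2, lintegral_const_mul' _ _ (expNeg_ne_top _)] at h1
    refine (ENNReal.mul_right_inj (expNeg_ne_zero ?_) (expNeg_ne_top _)).1 h1
    exact logLaplace_ne_top hA (lt_max_of_lt_right (hc0 n))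
  have hR : Tendsto (fun n => expNeg (ENNReal.ofReal lam * ∫⁻ u : Plane, (1 - expNeg (H n ‖u‖))))
      atTop (𝓝 (ENNReal.ofReal (Real.exp (-(lam * (K α 1 * (s / A) ^ (2 / α))))))) := by
    have h1 : Tendsto (fun n => ∫⁻ u : Plane, (1 - expNeg (H n ‖u‖))) atTop
        (𝓝 (ENNReal.ofReal (K α 1 * (s / A) ^ (2 / α)))) := by
      rw [← lintegral_one_sub_expNeg_logLaplace hA hα hs]
      refine lintegral_tendsto_of_tendsto_of_monotone
        (fun n => (hcontsub.comp ((hHcont n).comp continuous_norm)).measurable.aemeasurable)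
        (ae_of_all _ fun u m n hmn => ?_) (ae_of_all _ fun u => ?_)
      · exact tsub_le_tsub_left (antitone_expNeg (hHmono _ (norm_nonneg u) hmn)) _
      · exact (hcontsub.tendsto _).comp (hHlim _ (norm_nonneg u))
    have hK : 0 ≤ K α 1 * (s / A) ^ (2 / α) :=
      mul_nonneg (K_one_nonneg hα0) (by positivity)
    rw [← expNeg_ofReal (by positivity), ENNReal.ofReal_mul hlam.le]
    exact (continuous_expNeg.tendsto _).comp
      (ENNReal.Tendsto.const_mul h1 (Or.inr ENNReal.ofReal_ne_top))
  have hL : Tendsto (fun n => ∫⁻ ω, expNeg (∑' j, H n ‖x (j + 1) ω - z‖) ∂P) atTop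
      (𝓝 (∫⁻ ω, expNeg (∑' j, logLaplace A α s ‖x (j + 1) ω - z‖) ∂P)) := by
    refine tendsto_lintegral_of_dominated_convergence (fun _ => 1) (fun n => ?_)
      (fun n => ae_of_all _ fun ω => expNeg_le_one _) (by simp) (ae_of_all _ fun ω => ?_)
    · have hm := (hHcont n).measurable
      exact measurable_expNeg.comp (Measurable.tsum fun j =>
        hm.comp ((hx (j + 1)).sub_const z).norm)
    · refine (continuous_expNeg.tendsto _).comp ?_
      -- The series is read as an integral over counting measure, so that monotone convergence
      -- applies.
      simp_rw [← lintegral_count]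
      exact lintegral_tendsto_of_tendsto_of_monotone (fun n => measurable_from_top.aemeasurable)
        (ae_of_all _ fun j => hHmono _ (norm_nonneg _)) (ae_of_all _ fun j => hHlim _ (norm_nonneg _))
  simp_rw [hstep] at hL
  exact tendsto_nhds_unique hL hR

end Interference

/-! ### Averaging over Rayleigh fading. -/

section Fading
open Filter Topology

lemma lintegral_exp_neg_mul_Ioi (v : ℝ) {b : ℝ} (hb : 0 < b) :
    ∫⁻ x in Set.Ioi v, ENNReal.ofReal (Real.exp (-b * x)) =
      ENNReal.ofReal (Real.exp (-b * v) / b) := by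
  rw [← ofReal_integral_eq_lintegral_ofReal (integrableOn_exp_mul_Ioi (by linarith) v)
    (ae_of_all _ fun x => (Real.exp_pos _).le), integral_exp_mul_Ioi (by linarith) v]
  simp [div_neg, neg_div]

lemma lintegral_expMeasure_one {f : ℝ → ℝ≥0∞} (hf : Measurable f) :
    ∫⁻ x, f x ∂(expMeasure 1) = ∫⁻ x in Set.Ioi 0, ENNReal.ofReal (Real.exp (-1 * x)) * f x := by
  have h : expMeasure 1 = volume.withDensity (exponentialPDF 1) := rfl
  rw [h, lintegral_withDensity_eq_lintegral_mul _
    (show Measurable (exponentialPDF 1) from (measurable_exponentialPDFReal 1).ennreal_ofReal) hf,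
    setLIntegral_congr Ioi_ae_eq_Ici,
    ← lintegral_indicator measurableSet_Ici]
  refine lintegral_congr fun x => ?_
  by_cases hx : 0 ≤ x
  · simp [exponentialPDF_eq, hx]
  · simp [exponentialPDF_eq, hx]

/-- The threshold may be `∞`, since finiteness of the interference is not known at this stage. -/
lemma expMeasure_one_setOf_le (w : ℝ≥0∞) : expMeasure 1 {r | w ≤ ENNReal.ofReal r} = expNeg w := by
  have hm : MeasurableSet {r : ℝ | w ≤ ENNReal.ofReal r} :=
    measurableSet_le measurable_const ENNReal.measurable_ofReal
  rw [← lintegral_indicator_one hm, lintegral_expMeasure_one (measurable_one.indicator hm)]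
  induction w with
  | top => simp
  | coe w =>
    rw [← ENNReal.ofReal_coe_nnreal, expNeg_ofReal w.coe_nonneg,
      setLIntegral_congr Ioi_ae_eq_Ici]
    have := lintegral_exp_neg_mul_Ioi w one_pos
    rw [neg_one_mul, div_one] at this
    rw [← this, setLIntegral_congr (Ioi_ae_eq_Ici (a := (w : ℝ))),
      ← lintegral_indicator measurableSet_Ici, ← lintegral_indicator measurableSet_Ici]
    refine lintegral_congr fun x => ?_
    by_cases hx : (w : ℝ) ≤ x
    · have hx0 : 0 ≤ x := w.coe_nonneg.trans hx
      have : ENNReal.ofReal w ≤ ENNReal.ofReal x := ENNReal.ofReal_le_ofReal hx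
      simp only [Set.mem_Ici, hx0, hx, Set.indicator_of_mem, Set.indicator_apply,
        Set.mem_ofPred_eq, this, if_true, Pi.one_apply, mul_one]
    · by_cases hx0 : 0 ≤ x
      · have : ¬ ENNReal.ofReal w ≤ ENNReal.ofReal x := by
          rwa [ENNReal.ofReal_le_ofReal_iff hx0]
        simp only [Set.mem_Ici, hx0, Set.indicator_of_mem, hx, not_false_eq_true,
          Set.indicator_of_notMem, Set.mem_ofPred_eq, this, mul_zero]
      · simp [hx, hx0]

lemma lintegral_expNeg_mul_expMeasure_one (c : ℝ≥0∞) :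
    ∫⁻ r, expNeg (ENNReal.ofReal r * c) ∂(expMeasure 1) = expNeg (logOneAdd c) := by
  rw [expNeg_logOneAdd, lintegral_expMeasure_one (by fun_prop)]
  induction c with
  | top =>
    rw [add_top, ENNReal.inv_top, ← lintegral_zero (μ := volume.restrict (Set.Ioi (0 : ℝ)))]
    refine setLIntegral_congr_fun measurableSet_Ioi fun x hx => ?_
    have hx : 0 < x := hx
    simp [ENNReal.mul_top, hx]
  | coe c =>
    have h := lintegral_exp_neg_mul_Ioi 0 (b := 1 + c) (by positivity)
    rw [mul_zero, Real.exp_zero, one_div, ENNReal.ofReal_inv_of_pos (by positivity),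
      ENNReal.ofReal_add zero_le_one c.coe_nonneg, ENNReal.ofReal_one,
      ENNReal.ofReal_coe_nnreal] at h
    rw [← h]
    refine setLIntegral_congr_fun measurableSet_Ioi fun x hx => ?_
    have hx : 0 < x := hx
    rw [← ENNReal.ofReal_coe_nnreal, ← ENNReal.ofReal_mul hx.le, expNeg_ofReal (by positivity),
      ← ENNReal.ofReal_mul (Real.exp_pos _).le, ← Real.exp_add]
    congr 2
    ring

variable {Ω : Type*} [MeasurableSpace Ω] {P : Measure Ω}

lemma ProbabilityTheory.IndepFun.lintegral_comp_prodMk [IsProbabilityMeasure P] {E E' : Type*}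
    [MeasurableSpace E] [MeasurableSpace E'] {X : Ω → E} {Y : Ω → E'} (h : IndepFun X Y P)
    (hX : Measurable X) (hY : Measurable Y) {f : E → E' → ℝ≥0∞}
    (hf : Measurable (Function.uncurry f)) :
    ∫⁻ ω, f (X ω) (Y ω) ∂P = ∫⁻ ω, ∫⁻ ω', f (X ω') (Y ω) ∂P ∂P := by
  have h1 := (indepFun_iff_map_prod_eq_prod_map_map hX.aemeasurable hY.aemeasurable).1 h
  have : IsProbabilityMeasure (P.map X) := Measure.isProbabilityMeasure_map hX.aemeasurable
  have : IsProbabilityMeasure (P.map Y) := Measure.isProbabilityMeasure_map hY.aemeasurable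
  have h2 := lintegral_map (μ := P) hf (hX.prodMk hY)
  rw [h1, lintegral_prod_symm _ hf.aemeasurable, lintegral_map hf.lintegral_prod_left' hY] at h2
  rw [show ∫⁻ ω, f (X ω) (Y ω) ∂P = _ from h2.symm]
  exact lintegral_congr fun ω => lintegral_map (hf.comp measurable_prodMk_right) hX

/-- The second variable is measurable for the σ-algebra generated by all coordinates but `0`;
disjoint index sets generate independent σ-algebras. -/
lemma ProbabilityTheory.iIndepFun.indepFun_zero_succ {f : ℕ → Ω → ℝ} (hf : iIndepFun f P)
    (hm : ∀ j, Measurable (f j)) {E : Type*} [MeasurableSpace E] {W : (ℕ → ℝ) → E}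
    (hW : Measurable W) : IndepFun (f 0) (fun ω => W fun j => f (j + 1) ω) P := by
  have h := indep_iSup_of_disjoint (fun j => (hm j).comap_le) hf.iIndep
    (S := {0}) (T := {0}ᶜ) disjoint_compl_right
  refine indep_of_indep_of_le_left (indep_of_indep_of_le_right h ?_) (by simp)
  refine Measurable.comap_le (hW.comp ((@measurable_pi_iff Ω ℕ (fun _ => ℝ)
    (⨆ i ∈ ({0}ᶜ : Set ℕ), MeasurableSpace.comap (f i) inferInstance) _ _).2 fun j => ?_))
  exact (comap_measurable (f (j + 1))).mono
    (le_iSup₂_of_le (j + 1) (by simp) le_rfl) le_rfl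

lemma lintegral_expNeg_tsum_fading {f : ℕ → Ω → ℝ} [IsProbabilityMeasure P]
    (hf : iIndepFun f P) (hm : ∀ j, Measurable (f j)) (hlaw : ∀ j, P.map (f j) = expMeasure 1)
    (c : ℕ → ℝ≥0∞) :
    ∫⁻ ω, expNeg (∑' j, ENNReal.ofReal (f j ω) * c j) ∂P = expNeg (∑' j, logOneAdd (c j)) := by
  have hstep : ∀ n, ∫⁻ ω, expNeg (∑ j ∈ Finset.range n, ENNReal.ofReal (f j ω) * c j) ∂P =
      expNeg (∑ j ∈ Finset.range n, logOneAdd (c j)) := by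
    intro n
    have hg : ∀ j, Measurable fun r : ℝ => expNeg (ENNReal.ofReal r * c j) := fun j => by fun_prop
    simp_rw [expNeg_finsetSum]
    refine (lintegral_prod_eq_prod_lintegral_of_indepFun _ _ (hf.comp _ hg)
      fun j => (hg j).comp (hm j)).trans (Finset.prod_congr rfl fun j _ => ?_)
    rw [← lintegral_expNeg_mul_expMeasure_one, ← hlaw j, lintegral_map (hg j) (hm j)]
    rfl
  have hL : Tendsto (fun n => ∫⁻ ω, expNeg (∑ j ∈ Finset.range n, ENNReal.ofReal (f j ω) * c j) ∂P)
      atTop (𝓝 (∫⁻ ω, expNeg (∑' j, ENNReal.ofReal (f j ω) * c j) ∂P)) := by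
    refine tendsto_lintegral_of_dominated_convergence (fun _ => 1) (fun n => ?_)
      (fun n => ae_of_all _ fun ω => expNeg_le_one _) (by simp) (ae_of_all _ fun ω => ?_)
    · exact measurable_expNeg.comp (Finset.measurable_fun_sum _ fun j _ =>
        (hm j).ennreal_ofReal.mul_const _)
    · exact (continuous_expNeg.tendsto _).comp (ENNReal.tendsto_nat_tsum _)
  simp_rw [hstep] at hL
  exact tendsto_nhds_unique hL
    ((continuous_expNeg.tendsto _).comp (ENNReal.tendsto_nat_tsum _))

lemma ae_pos_of_map_eq_expMeasure {f : Ω → ℝ} (hm : Measurable f)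
    (hlaw : P.map f = expMeasure 1) : ∀ᵐ ω ∂P, 0 < f ω := by
  have h : ∀ᵐ r ∂(expMeasure 1), (0 : ℝ) < r := by
    rw [ae_iff, ← lintegral_indicator_one (by measurability),
      lintegral_expMeasure_one (measurable_one.indicator (by measurability)),
      ← lintegral_zero (μ := volume.restrict (Set.Ioi (0 : ℝ)))]
    refine setLIntegral_congr_fun measurableSet_Ioi fun x hx => ?_
    have hx : 0 < x := hx
    simp [hx]
  rw [← hlaw] at h
  exact ae_of_ae_map hm.aemeasurable h

/-- Given the value `w` of the left side, the useful fading exceeds it with probability `e^{-w}`.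
The average over `w` splits into noise and interference. -/
lemma measure_add_tsum_fading_le {f : ℕ → Ω → ℝ} [IsProbabilityMeasure P]
    (hf : iIndepFun f P) (hm : ∀ j, Measurable (f j)) (hlaw : ∀ j, P.map (f j) = expMeasure 1)
    (b : ℝ≥0∞) (c : ℕ → ℝ≥0∞) :
    P {ω | b + ∑' j, ENNReal.ofReal (f (j + 1) ω) * c j ≤ ENNReal.ofReal (f 0 ω)} =
      expNeg b * expNeg (∑' j, logOneAdd (c j)) := by
  have hW : Measurable fun g : ℕ → ℝ => b + ∑' j, ENNReal.ofReal (g j) * c j :=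
    measurable_const.add (Measurable.tsum fun j =>
      (measurable_pi_apply j).ennreal_ofReal.mul_const _)
  have hW' : Measurable fun ω => b + ∑' j, ENNReal.ofReal (f (j + 1) ω) * c j :=
    hW.comp (measurable_pi_iff.2 fun j => hm (j + 1))
  have hset : MeasurableSet {p : ℝ × ℝ≥0∞ | p.2 ≤ ENNReal.ofReal p.1} :=
    measurableSet_le measurable_snd measurable_fst.ennreal_ofReal
  have key := (hf.indepFun_zero_succ hm hW).lintegral_comp_prodMk (hm 0) hW'
    (f := fun r w => {p : ℝ × ℝ≥0∞ | p.2 ≤ ENNReal.ofReal p.1}.indicator 1 (r, w))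
    (measurable_one.indicator hset)
  have h1 : ∀ w : ℝ≥0∞, ∫⁻ ω', {p : ℝ × ℝ≥0∞ | p.2 ≤ ENNReal.ofReal p.1}.indicator 1 (f 0 ω', w) ∂P
      = expNeg w := by
    intro w
    have hw : MeasurableSet {r : ℝ | w ≤ ENNReal.ofReal r} :=
      measurableSet_le measurable_const ENNReal.measurable_ofReal
    rw [← expMeasure_one_setOf_le, ← hlaw 0, Measure.map_apply (hm 0) hw,
      ← lintegral_indicator_one (hm 0 hw)]
    rfl
  simp_rw [h1] at key
  rw [← lintegral_indicator_one (measurableSet_le hW' (hm 0).ennreal_ofReal)]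
  refine Eq.trans ?_ (key.trans ?_)
  · rfl
  · simp_rw [expNeg_add]
    rw [lintegral_const_mul' _ _ (expNeg_ne_top _), lintegral_expNeg_tsum_fading
      (hf.precomp (g := Nat.succ) Nat.succ_injective) (fun j => hm _) (fun j => hlaw _)]

end Fading

/-! ### Coverage given the transmitters, and its mean. -/

section Coverage
open Filter Topology

/-- Independence means that the joint law is a product measure, and a product over `ι × κ` is a
product over `ι` of products over `κ`. -/
lemma ProbabilityTheory.iIndepFun.curry {Ω ι κ E : Type*} [MeasurableSpace Ω] [MeasurableSpace E]
    {P : Measure Ω} [IsProbabilityMeasure P] {X : ι → κ → Ω → E}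
    (h : iIndepFun (fun p : ι × κ => X p.1 p.2) P) (hm : ∀ i j, Measurable (X i j)) :
    iIndepFun (fun i ω j => X i j ω) P := by
  have hp : ∀ i j, IsProbabilityMeasure (P.map (X i j)) := fun i j =>
    Measure.isProbabilityMeasure_map (hm i j).aemeasurable
  have hrow : ∀ i, P.map (fun ω j => X i j ω) = Measure.infinitePi fun j => P.map (X i j) :=
    fun i => iIndepFun.map_fun_eq_infinitePi_map (hm i)
      (h.precomp (g := fun j => (i, j)) (Prod.mk_right_injective i))
  have hall := iIndepFun.map_fun_eq_infinitePi_map (fun p : ι × κ => hm p.1 p.2) h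
  rw [iIndepFun_iff_map_fun_eq_infinitePi_map fun i => measurable_pi_iff.2 (hm i)]
  simp_rw [hrow]
  rw [← Measure.infinitePi_map_curry (fun i j => P.map (X i j)), ← hall,
    Measure.map_map (MeasurableEquiv.measurable _)
      (measurable_pi_lambda (fun ω (p : ι × κ) => X p.1 p.2 ω) fun p => hm p.1 p.2)]
  rfl

variable {A α b T : ℝ}

lemma measurable_pathLoss : Measurable (pathLoss A α) := by
  unfold pathLoss; fun_prop

@[fun_prop]
lemma Measurable.pathLoss {E : Type*} [MeasurableSpace E] {f : E → ℝ} (hf : Measurable f) :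
    Measurable fun e => pathLoss A α (f e) := measurable_pathLoss.comp hf

lemma measurable_sinr {ℓ : ℝ → ℝ} (hℓ : Measurable ℓ) (b : ℝ) {E : Type*} [MeasurableSpace E]
    {x : E → ℕ → Plane} {f : E → ℕ → ℝ} {z : E → Plane} (hx : ∀ j, Measurable fun e => x e j)
    (hf : ∀ j, Measurable fun e => f e j) (hz : Measurable z) :
    Measurable fun e => sinr ℓ b (x e) (f e) (z e) := by
  unfold sinr
  have hI : Measurable fun e => ∑' j, ENNReal.ofReal (f e (j + 1)) /
      ENNReal.ofReal (ℓ ‖x e (j + 1) - z e‖) := Measurable.tsum fun j =>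
    (hf (j + 1)).ennreal_ofReal.div (hℓ.comp ((hx (j + 1)).sub hz).norm).ennreal_ofReal
  exact ((hf 0).ennreal_ofReal.div (hℓ.comp hz.norm).ennreal_ofReal).div (hI.const_add _)

lemma measurableSet_covered {ℓ : ℝ → ℝ} (hℓ : Measurable ℓ) (b T : ℝ) {τ : ℕ} {E : Type*}
    [MeasurableSpace E] {x : E → Fin τ → ℕ → Plane} {f : E → Fin τ → ℕ → ℝ} {z : E → Plane}
    (hx : ∀ k j, Measurable fun e => x e k j) (hf : ∀ k j, Measurable fun e => f e k j)
    (hz : Measurable z) : MeasurableSet {e | Covered ℓ b T (x e) (f e) (z e)} := by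
  have : {e | Covered ℓ b T (x e) (f e) (z e)} =
      ⋃ k, {e | ENNReal.ofReal T ≤ sinr ℓ b (x e k) (f e k) (z e)} := by
    ext e; simp [Covered]
  rw [this]
  exact MeasurableSet.iUnion fun k =>
    measurableSet_le measurable_const (measurable_sinr hℓ b (hx k) (hf k) hz)

/-- The probability that a receiver at `z` is covered in one slot, given the transmitters, where
`S` is the logarithmic decrease of the Laplace transform of the interference. -/
noncomputable def slotCoverage (A α b T : ℝ) (z : Plane) (S : ℝ≥0∞) : ℝ≥0∞ :=
  expNeg (ENNReal.ofReal (T * pathLoss A α ‖z‖ * b)) * expNeg S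

lemma Measurable.slotCoverage {E : Type*} [MeasurableSpace E] {z : E → Plane} {S : E → ℝ≥0∞}
    (hz : Measurable z) (hS : Measurable S) :
    Measurable fun e => slotCoverage A α b T (z e) (S e) := by
  unfold _root_.slotCoverage; fun_prop

lemma slotCoverage_le_one (z : Plane) (S : ℝ≥0∞) : slotCoverage A α b T z S ≤ 1 :=
  mul_le_one' (expNeg_le_one _) (expNeg_le_one _)

/-- The logarithmic decrease, due to the transmitters `x j`, `j ≥ 1`, of the Laplace transform of
the interference at `z`. -/
noncomputable def logLaplaceSum (A α T : ℝ) (z : Plane) (x : ℕ → Plane) : ℝ≥0∞ :=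
  ∑' j, logLaplace A α (T * pathLoss A α ‖z‖) ‖x (j + 1) - z‖

/-- The received power is neither `0` nor `∞`, so the denominator can be cleared in `[0, ∞]` even
where noise plus interference is `0` or `∞`. -/
lemma le_sinr_iff (hA : 0 < A) (hT : 0 < T) {x : ℕ → Plane} {f : ℕ → ℝ} {z : Plane}
    (hz : z ≠ 0) (hf : 0 < f 0) :
    ENNReal.ofReal T ≤ sinr (pathLoss A α) b x f z ↔
      ENNReal.ofReal (T * pathLoss A α ‖z‖ * b) + ∑' j, ENNReal.ofReal (f (j + 1)) *
        (ENNReal.ofReal (T * pathLoss A α ‖z‖) / ENNReal.ofReal (pathLoss A α ‖x (j + 1) - z‖)) ≤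
      ENNReal.ofReal (f 0) := by
  have hℓ : 0 < pathLoss A α ‖z‖ := pathLoss_pos hA (norm_pos_iff.2 hz)
  have hℓ' : ENNReal.ofReal (pathLoss A α ‖z‖) ≠ 0 := by simpa using hℓ
  have hnum : ENNReal.ofReal (f 0) / ENNReal.ofReal (pathLoss A α ‖z‖) ≠ 0 :=
    ENNReal.div_ne_zero.2 ⟨by simpa using hf, ENNReal.ofReal_ne_top⟩
  have hnum' : ENNReal.ofReal (f 0) / ENNReal.ofReal (pathLoss A α ‖z‖) ≠ ∞ :=
    ENNReal.div_ne_top ENNReal.ofReal_ne_top hℓ'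
  rw [sinr, ENNReal.le_div_iff_mul_le (Or.inr hnum) (Or.inr hnum'),
    ENNReal.le_div_iff_mul_le (Or.inl hℓ') (Or.inl ENNReal.ofReal_ne_top)]
  have : ENNReal.ofReal (T * pathLoss A α ‖z‖ * b) + ∑' j, ENNReal.ofReal (f (j + 1)) *
        (ENNReal.ofReal (T * pathLoss A α ‖z‖) / ENNReal.ofReal (pathLoss A α ‖x (j + 1) - z‖)) =
      ENNReal.ofReal T * (ENNReal.ofReal b + ∑' j, ENNReal.ofReal (f (j + 1)) /
        ENNReal.ofReal (pathLoss A α ‖x (j + 1) - z‖)) * ENNReal.ofReal (pathLoss A α ‖z‖) := by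
    rw [mul_right_comm (ENNReal.ofReal T), ← ENNReal.ofReal_mul hT.le, mul_add,
      ← ENNReal.ofReal_mul (by positivity),
      ← ENNReal.tsum_mul_left]
    congr 2
    ext j
    rw [div_eq_mul_inv, div_eq_mul_inv]
    ring
  rw [this]

variable {Ω : Type*} [MeasurableSpace Ω] {P : Measure Ω}

lemma measure_le_sinr [IsProbabilityMeasure P] (hA : 0 < A) (hT : 0 < T) {f : ℕ → Ω → ℝ}
    (hf : iIndepFun f P) (hm : ∀ j, Measurable (f j)) (hlaw : ∀ j, P.map (f j) = expMeasure 1)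
    (x : ℕ → Plane) {z : Plane} (hz : z ≠ 0) :
    P {ω | ENNReal.ofReal T ≤ sinr (pathLoss A α) b x (fun j => f j ω) z} =
      slotCoverage A α b T z (logLaplaceSum A α T z x) := by
  refine Eq.trans (measure_congr ?_) (measure_add_tsum_fading_le hf hm hlaw
    (ENNReal.ofReal (T * pathLoss A α ‖z‖ * b)) fun j =>
      ENNReal.ofReal (T * pathLoss A α ‖z‖) / ENNReal.ofReal (pathLoss A α ‖x (j + 1) - z‖))
  filter_upwards [ae_pos_of_map_eq_expMeasure (hm 0) (hlaw 0)] with ω hω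
  exact propext (le_sinr_iff hA hT hz hω)

/-- The complement is failure in every slot, and with fixed transmitters the slots involve
independent fading rows. -/
lemma measure_covered [IsProbabilityMeasure P] (hA : 0 < A) (hT : 0 < T) {τ : ℕ}
    {f : Fin τ → ℕ → Ω → ℝ}
    (hf : iIndepFun (fun p : Fin τ × ℕ => f p.1 p.2) P) (hm : ∀ k j, Measurable (f k j))
    (hlaw : ∀ k j, P.map (f k j) = expMeasure 1) (x : Fin τ → ℕ → Plane) {z : Plane}
    (hz : z ≠ 0) :
    P {ω | Covered (pathLoss A α) b T x (fun k j => f k j ω) z} =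
      1 - ∏ k, (1 - slotCoverage A α b T z (logLaplaceSum A α T z (x k))) := by
  have hmeas : ∀ k, MeasurableSet {g : ℕ → ℝ | ENNReal.ofReal T ≤ sinr (pathLoss A α) b (x k) g z} :=
    fun k => measurableSet_le measurable_const (measurable_sinr measurable_pathLoss b
      (fun j => measurable_const) (fun j => measurable_pi_apply j) measurable_const)
  have hmeasω : ∀ k, MeasurableSet
      {ω | ENNReal.ofReal T ≤ sinr (pathLoss A α) b (x k) (fun j => f k j ω) z} := fun k =>
    (measurable_pi_iff.2 (hm k)) (hmeas k)
  have hmc := measurableSet_covered (measurable_pathLoss (A := A) (α := α)) b T (E := Ω)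
    (x := fun _ => x) (f := fun ω k j => f k j ω) (z := fun _ => z)
    (fun k j => measurable_const) hm measurable_const
  have hcompl : P {ω | Covered (pathLoss A α) b T x (fun k j => f k j ω) z}ᶜ =
      ∏ k, (1 - slotCoverage A α b T z (logLaplaceSum A α T z (x k))) := by
    have h1 : {ω | Covered (pathLoss A α) b T x (fun k j => f k j ω) z}ᶜ =
        ⋂ k, (fun ω j => f k j ω) ⁻¹'
          {g : ℕ → ℝ | ENNReal.ofReal T ≤ sinr (pathLoss A α) b (x k) g z}ᶜ := by
      ext ω; simp [Covered]
    rw [h1, (hf.curry hm).meas_iInter fun k => ⟨_, (hmeas k).compl, rfl⟩]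
    refine Finset.prod_congr rfl fun k _ => ?_
    rw [← measure_le_sinr hA hT
      (hf.precomp (g := fun j => (k, j)) (Prod.mk_right_injective k)) (hm k) (hlaw k) (x k) hz,
      ← prob_compl_eq_one_sub (hmeasω k)]
    rfl
  rw [← hcompl, ← prob_compl_eq_one_sub hmc.compl, compl_compl]

/-- The coverage probability in one slot at `z`. -/
noncomputable def meanSlotCoverage (lam A α b T : ℝ) (z : Plane) : ℝ :=
  Real.exp (-(T * pathLoss A α ‖z‖ * b)) *
    Real.exp (-(lam * (K α 1 * (T * pathLoss A α ‖z‖ / A) ^ (2 / α))))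

lemma meanSlotCoverage_nonneg (lam A α b T : ℝ) (z : Plane) :
    0 ≤ meanSlotCoverage lam A α b T z := by unfold meanSlotCoverage; positivity

lemma meanSlotCoverage_le_one {lam : ℝ} (hlam : 0 ≤ lam) (hA : 0 < A) (hα : 0 < α) (hT : 0 < T)
    (hb : 0 ≤ b) (z : Plane) : meanSlotCoverage lam A α b T z ≤ 1 := by
  have h1 := pathLoss_nonneg (α := α) hA.le (norm_nonneg z)
  have h2 := K_one_nonneg hα
  refine mul_le_one₀ (Real.exp_le_one_iff.2 ?_) (Real.exp_pos _).le (Real.exp_le_one_iff.2 ?_)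
  · rw [neg_nonpos]; positivity
  · rw [neg_nonpos]; positivity

lemma lintegral_one_sub [IsProbabilityMeasure P] {g : Ω → ℝ≥0∞} (hg : Measurable g)
    (h1 : ∀ ω, g ω ≤ 1) :
    ∫⁻ ω, (1 - g ω) ∂P = 1 - ∫⁻ ω, g ω ∂P := by
  rw [lintegral_sub hg (ne_top_of_le_ne_top (by simp) (lintegral_mono h1)) (ae_of_all _ h1)]
  simp

variable {Q : Measure (Measure Plane)} {τ : ℕ} {lamM lamR R : ℝ}
  {x : Fin τ → ℕ → Ω → Plane} {M : Ω → ℕ} {y : ℕ → Ω → Plane} {F : Fin τ → ℕ → ℕ → Ω → ℝ}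

/-- Independence is assumed for the point processes and not for the labelled points, so the sum over
interferers is rewritten as a functional of the process. The subtracted term of the typical
transmitter is finite because `z ≠ 0`. -/
lemma logLaplaceSum_ae_eq (hA : 0 < A) (hα : 0 < α)
    (h : IsHighMobilityCluster P Q τ lamM lamR R x M y F) (k : Fin τ) :
    ∀ᵐ ω ∂P, ∀ z : Plane, z ≠ 0 → logLaplaceSum A α T z (fun j => x k j ω) =
      ∫⁻ u, logLaplace A α (T * pathLoss A α ‖z‖) ‖u - z‖ ∂(pointProcess (x k) ω) -
        logLaplace A α (T * pathLoss A α ‖z‖) ‖z‖ := by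
  filter_upwards [h.tx_zero k] with ω hω z hz
  have hm := (continuous_logLaplace (A := A) (s := T * pathLoss A α ‖z‖) hα.le).measurable
  rw [lintegral_pointProcess (x k) ω
      (f := fun u => logLaplace A α (T * pathLoss A α ‖z‖) ‖u - z‖) (by fun_prop),
    tsum_eq_zero_add' ENNReal.summable, hω, zero_sub, norm_neg,
    ENNReal.add_sub_cancel_left (logLaplace_ne_top hA (norm_pos_iff.2 hz))]
  rfl

/-- High mobility enters here: the failure probabilities given the transmitters are functionals of
independent processes, so the mean of their product is the product of their means. -/
lemma lintegral_one_sub_prod_slotCoverage [IsProbabilityMeasure P]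
    (hlamM : 0 < lamM) (hA : 0 < A) (hα : 2 < α)
    (hT : 0 < T) (hb : 0 ≤ b)
    (hQ : IsPoissonPointProcessLaw Q (ENNReal.ofReal lamM • (volume : Measure Plane)))
    (h : IsHighMobilityCluster P Q τ lamM lamR R x M y F) {z : Plane} (hz : z ≠ 0) :
    ∫⁻ ω, (1 - ∏ k, (1 - slotCoverage A α b T z (logLaplaceSum A α T z fun j => x k j ω))) ∂P =
      ENNReal.ofReal (1 - (1 - meanSlotCoverage lamM A α b T z) ^ τ) := by
  have hα0 : 0 < α := by linarith
  have hq0 := meanSlotCoverage_nonneg lamM A α b T z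
  have hq1 := meanSlotCoverage_le_one (A := A) (T := T) (b := b) hlamM.le hA hα0 hT hb z
  set s := T * pathLoss A α ‖z‖ with hs
  have hs0 : 0 < s := mul_pos hT (pathLoss_pos hA (norm_pos_iff.2 hz))
  have hm := (continuous_logLaplace (A := A) (s := s) hα0.le).measurable
  let G : Measure Plane → ℝ≥0∞ := fun φ =>
    1 - slotCoverage A α b T z (∫⁻ u, logLaplace A α s ‖u - z‖ ∂φ - logLaplace A α s ‖z‖)
  have hG : Measurable G := by
    have : Measurable fun φ : Measure Plane => ∫⁻ u, logLaplace A α s ‖u - z‖ ∂φ :=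
      Measure.measurable_lintegral (by fun_prop)
    exact measurable_const.sub (measurable_const.slotCoverage (this.sub_const _))
  have hpm : ∀ k, Measurable (pointProcess (x k)) := fun k =>
    measurable_pointProcess (h.measurable_tx k)
  have hSm : ∀ k, Measurable fun ω => logLaplaceSum A α T z fun j => x k j ω := fun k =>
    Measurable.tsum fun j => hm.comp ((h.measurable_tx k (j + 1)).sub_const z).norm
  have hGeq : ∀ k, (fun ω => 1 - slotCoverage A α b T z (logLaplaceSum A α T z fun j => x k j ω))
      =ᵐ[P] fun ω => G (pointProcess (x k) ω) := by
    intro k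
    filter_upwards [logLaplaceSum_ae_eq hA hα0 h k] with ω hω
    rw [hω z hz]
  have hone : ∀ k, ∫⁻ ω, G (pointProcess (x k) ω) ∂P =
      ENNReal.ofReal (1 - meanSlotCoverage lamM A α b T z) := by
    intro k
    rw [← lintegral_congr_ae (hGeq k), lintegral_one_sub (measurable_const.slotCoverage (hSm k))
      (fun ω => slotCoverage_le_one z _)]
    unfold slotCoverage logLaplaceSum
    rw [lintegral_const_mul' _ _ (expNeg_ne_top _), lintegral_expNeg_tsum_logLaplace hlamM hA hα hs0
      hQ (h.measurable_tx k) (h.tx_zero k) (h.tx_palm k) z, expNeg_ofReal (by positivity),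
      ← ENNReal.ofReal_mul (Real.exp_pos _).le, ENNReal.ofReal_sub _ hq0, ENNReal.ofReal_one]
    rfl
  have hprod : ∫⁻ ω, ∏ k, (1 - slotCoverage A α b T z (logLaplaceSum A α T z fun j => x k j ω)) ∂P =
      ENNReal.ofReal ((1 - meanSlotCoverage lamM A α b T z) ^ τ) := by
    have h1 : ∀ᵐ ω ∂P, ∏ k, (1 - slotCoverage A α b T z (logLaplaceSum A α T z fun j => x k j ω)) =
        ∏ k, G (pointProcess (x k) ω) := by
      filter_upwards [ae_all_iff.2 hGeq] with ω hω
      exact Finset.prod_congr rfl fun k _ => hω k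
    rw [lintegral_congr_ae h1]
    refine (lintegral_prod_eq_prod_lintegral_of_indepFun Finset.univ _
      (h.tx_indep.comp (fun _ => G) fun _ => hG) fun k => hG.comp (hpm k)).trans ?_
    simp only [Function.comp_apply, hone, Finset.prod_const, Finset.card_univ, Fintype.card_fin]
    rw [ENNReal.ofReal_pow (by linarith)]
  have hle : ∀ ω, ∏ k, (1 - slotCoverage A α b T z (logLaplaceSum A α T z fun j => x k j ω)) ≤ 1 :=
    fun ω => Finset.prod_le_one' fun k _ => tsub_le_self
  have hprodm : Measurable fun ω =>
      ∏ k, (1 - slotCoverage A α b T z (logLaplaceSum A α T z fun j => x k j ω)) :=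
    Finset.measurable_fun_prod _ fun k _ => (measurable_const.slotCoverage (hSm k)).const_sub 1
  rw [lintegral_one_sub hprodm hle, hprod, ENNReal.ofReal_sub _ (pow_nonneg (by linarith) _),
    ENNReal.ofReal_one]

end Coverage

/-! ### Coverage probability at a fixed location. -/

section ClusterCoverage
open Filter Topology

variable {A α b T : ℝ} {Ω : Type*} [MeasurableSpace Ω] {P : Measure Ω} {Q : Measure (Measure Plane)}
  {τ : ℕ} {lamM lamR R : ℝ} {x : Fin τ → ℕ → Ω → Plane} {M : Ω → ℕ} {y : ℕ → Ω → Plane}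
  {F : Fin τ → ℕ → ℕ → Ω → ℝ}

namespace IsHighMobilityCluster

lemma measurable_fadings (h : IsHighMobilityCluster P Q τ lamM lamR R x M y F) :
    Measurable fun ω => fun a : Fin τ × ℕ × ℕ => F a.1 a.2.1 a.2.2 ω :=
  measurable_pi_iff.2 fun _ => h.measurable_fading _ _ _

lemma measurable_positions (h : IsHighMobilityCluster P Q τ lamM lamR R x M y F) :
    Measurable fun ω => ((fun k j => x k j ω : Fin τ → ℕ → Plane), (M ω, fun i => y i ω)) :=
  (measurable_pi_iff.2 fun k => measurable_pi_iff.2 fun j => h.measurable_tx k j).prodMk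
    (h.measurable_rxCount.prodMk (measurable_pi_iff.2 h.measurable_rx))

lemma iIndepFun_fading_receiver (h : IsHighMobilityCluster P Q τ lamM lamR R x M y F) (i : ℕ) :
    iIndepFun (fun p : Fin τ × ℕ => F p.1 i p.2) P :=
  h.fading_iIndep.precomp (g := fun p : Fin τ × ℕ => (p.1, i, p.2)) fun p q hpq => by
    simp only [Prod.mk.injEq, true_and] at hpq
    exact Prod.ext hpq.1 hpq.2

/-- Averaging over the fading first. -/
lemma measure_covered_eq_lintegral [IsProbabilityMeasure P]
    (h : IsHighMobilityCluster P Q τ lamM lamR R x M y F) {ℓ : ℝ → ℝ} (hℓ : Measurable ℓ) (i : ℕ)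
    {D : Set ℕ} {Z : (ℕ → Plane) → Plane} (hZ : Measurable Z) :
    P {ω | M ω ∈ D ∧ Covered ℓ b T (fun k j => x k j ω) (fun k j => F k i j ω)
        (Z fun i => y i ω)} =
      ∫⁻ ω, D.indicator 1 (M ω) * P {ω' | Covered ℓ b T (fun k j => x k j ω)
        (fun k j => F k i j ω') (Z fun i => y i ω)} ∂P := by
  -- `D = univ` with constant `Z` serves a fixed location; `D = Set.Ioi i` with the `i`-th
  -- coordinate serves an actual receiver.
  set S : Set ((Fin τ × ℕ × ℕ → ℝ) × ((Fin τ → ℕ → Plane) × (ℕ × (ℕ → Plane)))) :=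
    {p | p.2.2.1 ∈ D ∧ Covered ℓ b T p.2.1 (fun k j => p.1 (k, i, j)) (Z p.2.2.2)} with hSdef
  have hS : MeasurableSet S := by
    refine MeasurableSet.inter (measurable_fst.comp (measurable_snd.comp measurable_snd)
      (MeasurableSet.of_discrete (s := D))) ?_
    exact measurableSet_covered hℓ b T (fun k j => by fun_prop) (fun k j => by fun_prop)
      (hZ.comp (by fun_prop))
  have key := h.fading_indep.lintegral_comp_prodMk h.measurable_fadings h.measurable_positions
    (f := fun g p => S.indicator 1 (g, p)) (measurable_one.indicator hS)
  have hmeas : MeasurableSet {ω | M ω ∈ D ∧ Covered ℓ b T (fun k j => x k j ω)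
      (fun k j => F k i j ω) (Z fun i => y i ω)} :=
    (h.measurable_fadings.prodMk h.measurable_positions) hS
  rw [← lintegral_indicator_one hmeas]
  refine Eq.trans ?_ (key.trans (lintegral_congr fun ω => ?_))
  · rfl
  · by_cases hD : M ω ∈ D
    · have hmeas' : MeasurableSet {ω' | Covered ℓ b T (fun k j => x k j ω)
          (fun k j => F k i j ω') (Z fun i => y i ω)} :=
        measurableSet_covered hℓ b T (fun k j => measurable_const)
          (fun k j => h.measurable_fading k i j) measurable_const
      rw [Set.indicator_of_mem hD, Pi.one_apply, one_mul, ← lintegral_indicator_one hmeas']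
      refine lintegral_congr fun ω' => ?_
      classical
      simp only [Set.indicator_apply, hSdef, Set.mem_ofPred_eq, hD, true_and, Pi.one_apply]
    · rw [Set.indicator_of_notMem hD, zero_mul, ← lintegral_zero (μ := P)]
      refine lintegral_congr fun ω' => ?_
      classical
      simp only [Set.indicator_apply, hSdef, Set.mem_ofPred_eq, hD, false_and, if_false]

lemma measure_covered_of_ne_zero [IsProbabilityMeasure P]
    (h : IsHighMobilityCluster P Q τ lamM lamR R x M y F) (hlamM : 0 < lamM) (hA : 0 < A)
    (hα : 2 < α) (hT : 0 < T) (hb : 0 ≤ b)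
    (hQ : IsPoissonPointProcessLaw Q (ENNReal.ofReal lamM • (volume : Measure Plane)))
    (i : ℕ) {z : Plane} (hz : z ≠ 0) :
    P {ω | Covered (pathLoss A α) b T (fun k j => x k j ω) (fun k j => F k i j ω) z} =
      ENNReal.ofReal (1 - (1 - meanSlotCoverage lamM A α b T z) ^ τ) := by
  have h1 := h.measure_covered_eq_lintegral (b := b) (T := T)
    (measurable_pathLoss (A := A) (α := α)) i (D := Set.univ) (Z := fun _ => z) measurable_const
  simp only [Set.mem_univ, true_and, Set.indicator_univ, Pi.one_apply, one_mul] at h1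
  rw [h1, ← lintegral_one_sub_prod_slotCoverage hlamM hA hα hT hb hQ h hz]
  exact lintegral_congr fun ω => measure_covered hA hT (h.iIndepFun_fading_receiver i)
    (fun k j => h.measurable_fading k i j) (fun k j => h.fading_law k i j) _ hz

/-- `P(I < ∞) ≥ E[e^{-sI}]` for every `s > 0`, and the explicit Laplace transform tends to `1` as `s
→ 0`. -/
lemma ae_interference_lt_top [IsProbabilityMeasure P]
    (h : IsHighMobilityCluster P Q τ lamM lamR R x M y F) (hlamM : 0 < lamM) (hA : 0 < A)
    (hα : 2 < α)
    (hQ : IsPoissonPointProcessLaw Q (ENNReal.ofReal lamM • (volume : Measure Plane)))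
    (i : ℕ) (k : Fin τ) (z : Plane) :
    ∀ᵐ ω ∂P, ∑' j, ENNReal.ofReal (F k i (j + 1) ω) /
      ENNReal.ofReal (pathLoss A α ‖x k (j + 1) ω - z‖) < ∞ := by
  set I : Ω → ℝ≥0∞ := fun ω => ∑' j, ENNReal.ofReal (F k i (j + 1) ω) /
      ENNReal.ofReal (pathLoss A α ‖x k (j + 1) ω - z‖) with hI
  have hα0 : 0 < α := by linarith
  have hIm : Measurable I := Measurable.tsum fun j =>
    (h.measurable_fading k i (j + 1)).ennreal_ofReal.div
      ((h.measurable_tx k (j + 1)).sub_const z).norm.pathLoss.ennreal_ofReal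
  have hLap : ∀ s : ℝ, 0 < s → ∫⁻ ω, expNeg (ENNReal.ofReal s * I ω) ∂P =
      ENNReal.ofReal (Real.exp (-(lamM * (K α 1 * (s / A) ^ (2 / α))))) := by
    intro s hs
    have hf : Measurable (Function.uncurry fun (g : Fin τ × ℕ × ℕ → ℝ)
        (p : (Fin τ → ℕ → Plane) × (ℕ × (ℕ → Plane))) =>
        expNeg (∑' j, ENNReal.ofReal (g (k, i, j + 1)) *
          (ENNReal.ofReal s / ENNReal.ofReal (pathLoss A α ‖p.1 k (j + 1) - z‖)))) := by
      refine measurable_expNeg.comp (Measurable.tsum fun j => ?_)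
      fun_prop
    have key := h.fading_indep.lintegral_comp_prodMk h.measurable_fadings h.measurable_positions hf
    have hfad : iIndepFun (fun j => F k i (j + 1)) P :=
      (h.iIndepFun_fading_receiver i).precomp (g := fun j => (k, j + 1)) fun a b hab => by
        simpa using hab
    have hin : ∀ ω, ∫⁻ ω', expNeg (∑' j, ENNReal.ofReal (F k i (j + 1) ω') *
        (ENNReal.ofReal s / ENNReal.ofReal (pathLoss A α ‖x k (j + 1) ω - z‖))) ∂P =
        expNeg (∑' j, logLaplace A α s ‖x k (j + 1) ω - z‖) := fun ω =>
      lintegral_expNeg_tsum_fading hfad (fun j => h.measurable_fading k i _)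
        (fun j => h.fading_law k i _) _
    rw [lintegral_congr hin, lintegral_expNeg_tsum_logLaplace hlamM hA hα hs hQ
      (h.measurable_tx k) (h.tx_zero k) (h.tx_palm k) z] at key
    rw [← key]
    refine lintegral_congr fun ω => ?_
    rw [hI]
    simp only
    rw [← ENNReal.tsum_mul_left]
    congr 2
    ext j
    rw [div_eq_mul_inv, div_eq_mul_inv]
    ring
  have hset : MeasurableSet {ω | I ω < ∞} := measurableSet_lt hIm measurable_const
  have hle : ∀ n : ℕ, ENNReal.ofReal
      (Real.exp (-(lamM * (K α 1 * (1 / ((n : ℝ) + 1) / A) ^ (2 / α))))) ≤ P {ω | I ω < ∞} := by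
    intro n
    have hn : (0 : ℝ) < 1 / ((n : ℝ) + 1) := by positivity
    rw [← hLap _ hn, ← lintegral_indicator_one hset]
    refine lintegral_mono fun ω => ?_
    by_cases hω : I ω < ∞
    · rw [Set.indicator_of_mem (by exact hω)]
      exact expNeg_le_one _
    · rw [not_lt_top_iff.1 hω, ENNReal.mul_top (by simpa using hn)]
      simp
  have hlim : Tendsto (fun n : ℕ => ENNReal.ofReal
      (Real.exp (-(lamM * (K α 1 * (1 / ((n : ℝ) + 1) / A) ^ (2 / α)))))) atTop (𝓝 1) := by
    have h1 : Continuous fun s : ℝ => ENNReal.ofReal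
        (Real.exp (-(lamM * (K α 1 * (s / A) ^ (2 / α))))) := by
      have : Continuous fun s : ℝ => (s / A) ^ (2 / α) :=
        (continuous_id.div_const A).rpow_const fun _ => Or.inr (by positivity)
      exact ENNReal.continuous_ofReal.comp (by fun_prop)
    have h2 := (h1.tendsto 0).comp tendsto_one_div_add_atTop_nhds_zero_nat
    simpa [Real.zero_rpow (by positivity : 2 / α ≠ 0), Function.comp_def] using h2
  have h1 : P {ω | I ω < ∞} = 1 := le_antisymm prob_le_one (le_of_tendsto' hlim hle)
  exact (mem_ae_iff_prob_eq_one hset).2 h1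

/-- At the origin the path gain is infinite while the interference is almost surely finite, so the
SINR of any slot is infinite. -/
lemma measure_covered_zero [IsProbabilityMeasure P]
    (h : IsHighMobilityCluster P Q τ lamM lamR R x M y F) (hlamM : 0 < lamM) (hA : 0 < A)
    (hα : 2 < α)
    (hQ : IsPoissonPointProcessLaw Q (ENNReal.ofReal lamM • (volume : Measure Plane)))
    (i : ℕ) (hτ : τ ≠ 0) :
    P {ω | Covered (pathLoss A α) b T (fun k j => x k j ω) (fun k j => F k i j ω) 0} = 1 := by
  let k : Fin τ := ⟨0, Nat.pos_of_ne_zero hτ⟩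
  rw [← measure_univ (μ := P)]
  refine measure_congr ?_
  filter_upwards [h.ae_interference_lt_top hlamM hA hα hQ i k 0,
    ae_pos_of_map_eq_expMeasure (h.measurable_fading k i 0) (h.fading_law k i 0)] with ω hω hpos
  refine eq_true (⟨k, ?_⟩ : Covered (pathLoss A α) b T _ _ _)
  rw [sinr, norm_zero, pathLoss_zero (by linarith), ENNReal.ofReal_zero,
    ENNReal.div_zero (by simpa using hpos), ENNReal.top_div_of_ne_top]
  · exact le_top
  · exact ENNReal.add_ne_top.2 ⟨ENNReal.ofReal_ne_top, hω.ne⟩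

/-- The coverage probability at an arbitrary location. -/
theorem measure_covered [IsProbabilityMeasure P]
    (h : IsHighMobilityCluster P Q τ lamM lamR R x M y F) (hlamM : 0 < lamM) (hA : 0 < A)
    (hα : 2 < α) (hT : 0 < T) (hb : 0 ≤ b)
    (hQ : IsPoissonPointProcessLaw Q (ENNReal.ofReal lamM • (volume : Measure Plane)))
    (i : ℕ) (z : Plane) :
    P {ω | Covered (pathLoss A α) b T (fun k j => x k j ω) (fun k j => F k i j ω) z} =
      ENNReal.ofReal (1 - (1 - meanSlotCoverage lamM A α b T z) ^ τ) := by
  by_cases hz : z = 0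
  · subst hz
    have h1 : meanSlotCoverage lamM A α b T (0 : Plane) = 1 := by
      have h2 : 2 / α ≠ 0 := (div_pos two_pos (by linarith)).ne'
      simp [meanSlotCoverage, pathLoss_zero (A := A) (show α ≠ 0 by linarith), Real.zero_rpow h2]
    by_cases hτ : τ = 0
    · subst hτ
      simp [Covered]
    · rw [h.measure_covered_zero hlamM hA hα hQ i hτ, h1]
      simp [hτ]
  · exact h.measure_covered_of_ne_zero hlamM hA hα hT hb hQ i hz

end IsHighMobilityCluster
end ClusterCoverage

/-! ### Joint measurability of integrals against configurations. -/

section LocallyFiniteKernel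

/-- The kernel `φ ↦ φ(· ∩ S)` on the event that `φ S ∈ [m, m + 1)`. -/
noncomputable def restrictKernel {S : Set Plane} (hS : MeasurableSet S) (m : ℕ) :
    Kernel (Measure Plane) Plane :=
  open Classical in
  Kernel.piecewise (s := {φ : Measure Plane | φ S ∈ Set.Ico (m : ℝ≥0∞) (m + 1)})
    (Measure.measurable_coe hS measurableSet_Ico) (Kernel.restrict ⟨id, measurable_id⟩ hS) 0

instance {S : Set Plane} (hS : MeasurableSet S) (m : ℕ) : IsFiniteKernel (restrictKernel hS m) := by
  refine ⟨⟨m + 1, by finiteness, fun φ => ?_⟩⟩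
  rw [restrictKernel, Kernel.piecewise_apply]
  split_ifs with h
  · rw [Kernel.restrict_apply, Measure.restrict_apply_univ]
    exact h.2.le
  · simp

lemma tsum_restrictKernel_apply {S : Set Plane} (hS : MeasurableSet S) {φ : Measure Plane}
    (hφ : φ S < ∞) (B : Set Plane) (hB : MeasurableSet B) :
    ∑' m, restrictKernel hS m φ B = φ (B ∩ S) := by
  obtain ⟨m, hm⟩ : ∃ m : ℕ, φ S ∈ Set.Ico (m : ℝ≥0∞) (m + 1) := by
    lift φ S to NNReal using hφ.ne with r
    exact ⟨⌊r⌋₊, by exact_mod_cast Nat.floor_le (zero_le : 0 ≤ r),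
      by exact_mod_cast Nat.lt_floor_add_one r⟩
  rw [tsum_eq_single m]
  · rw [restrictKernel, Kernel.piecewise_apply, if_pos (by exact hm), Kernel.restrict_apply,
      Measure.restrict_apply hB]
    rfl
  · intro m' hm'
    rw [restrictKernel, Kernel.piecewise_apply, if_neg]
    · simp
    · intro h
      have h1 : (m : ℝ≥0∞) < m' + 1 := hm.1.trans_lt h.2
      have h2 : (m' : ℝ≥0∞) < m + 1 := h.1.trans_lt hm.2
      norm_cast at h1 h2
      omega

lemma measurableSet_annulus (n : ℕ) :
    MeasurableSet (disjointed (fun n : ℕ => Metric.ball (0 : Plane) n) n) :=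
  MeasurableSet.disjointed (fun _ => measurableSet_ball) n

/-- An s-finite kernel that sends every locally finite configuration to itself. -/
noncomputable def locallyFiniteKernel : Kernel (Measure Plane) Plane :=
  Kernel.sum fun n => Kernel.sum fun m => restrictKernel (measurableSet_annulus n) m

instance : IsSFiniteKernel locallyFiniteKernel := by
  unfold locallyFiniteKernel; infer_instance

/-- The identity kernel on all measures is not s-finite (counting measure on the plane is not). This
replacement is, and it agrees with the identity on the configurations that occur, so integrals
depending on a location and a configuration become jointly measurable. -/
lemma locallyFiniteKernel_apply {φ : Measure Plane}
    (hφ : ∀ n : ℕ, φ (Metric.ball 0 n) < ∞) : locallyFiniteKernel φ = φ := by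
  ext B hB
  rw [locallyFiniteKernel, Kernel.sum_apply' _ _ hB]
  simp_rw [Kernel.sum_apply' _ _ hB]
  have h1 : ∀ n, ∑' m, restrictKernel (measurableSet_annulus n) m φ B =
      φ (B ∩ disjointed (fun n : ℕ => Metric.ball (0 : Plane) n) n) := fun n =>
    tsum_restrictKernel_apply _
      ((measure_mono (disjointed_subset _ n)).trans_lt (hφ n)) B hB
  simp_rw [h1]
  rw [← measure_iUnion (fun i j hij => ((disjoint_disjointed _ hij).mono
      Set.inter_subset_right Set.inter_subset_right))
    (fun n => hB.inter (measurableSet_annulus n)), ← Set.inter_iUnion, iUnion_disjointed,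
    Metric.iUnion_ball_nat, Set.inter_univ]

end LocallyFiniteKernel

/-! ### Random receivers and the mean number covered. -/

section Receivers
open Filter Topology

variable {A α b T : ℝ} {Ω : Type*} [MeasurableSpace Ω] {P : Measure Ω} {Q : Measure (Measure Plane)}
  {τ : ℕ} {lamM lamR R : ℝ} {x : Fin τ → ℕ → Ω → Plane} {M : Ω → ℕ} {y : ℕ → Ω → Plane}
  {F : Fin τ → ℕ → ℕ → Ω → ℝ}

namespace IsHighMobilityCluster

/-- Campbell's formula for the receivers. -/
lemma tsum_lintegral_receiver (h : IsHighMobilityCluster P Q τ lamM lamR R x M y F)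
    {f : Plane → ℝ≥0∞} (hf : Measurable f) :
    ∑' i, ∫⁻ ω, (Set.Ioi i).indicator 1 (M ω) * f (y i ω) ∂P =
      ENNReal.ofReal lamR * ∫⁻ z in Metric.ball 0 R, f z := by
  have hM : ∀ i, MeasurableSet {ω | i < M ω} := fun i =>
    h.measurable_rxCount (MeasurableSet.of_discrete (s := Set.Ioi i))
  have hind : ∀ (i : ℕ) (g : Plane → ℝ≥0∞),
      ∫⁻ ω, (Set.Ioi i).indicator 1 (M ω) * g (y i ω) ∂P = ∫⁻ ω in {ω | i < M ω}, g (y i ω) ∂P := by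
    intro i g
    rw [← lintegral_indicator (hM i)]
    refine lintegral_congr fun ω => ?_
    by_cases hi : i < M ω
    · simp [hi]
    · simp [hi]
  -- The laws of `y i` on `{i < M}` add up to the intensity measure; integrating `f` against both
  -- sides gives the formula.
  have hmeas : Measure.sum (fun i => (P.restrict {ω | i < M ω}).map (y i)) =
      ENNReal.ofReal lamR • (volume : Measure Plane).restrict (Metric.ball 0 R) := by
    ext S hS
    rw [Measure.sum_apply _ hS, Measure.smul_apply, Measure.restrict_apply hS, smul_eq_mul,
      ← h.rx_intensity S hS]
    have h1 : ∀ i, (P.restrict {ω | i < M ω}).map (y i) S =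
        ∫⁻ ω, (Set.Ioi i).indicator 1 (M ω) * S.indicator 1 (y i ω) ∂P := by
      intro i
      rw [hind, ← lintegral_map (f := S.indicator 1) (measurable_one.indicator hS)
        (h.measurable_rx i), lintegral_indicator_one hS]
    simp_rw [h1]
    rw [← lintegral_tsum fun i => ?_]
    · refine lintegral_congr fun ω => ?_
      rw [finitePointProcess, Measure.finsetSum_apply, tsum_eq_sum (s := Finset.range (M ω))]
      · refine Finset.sum_congr rfl fun i hi => ?_
        rw [Measure.dirac_apply' _ hS]
        simp [Finset.mem_range.1 hi]
      · intro i hi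
        simp [Finset.mem_range.not.1 hi]
    · exact ((measurable_one.indicator MeasurableSet.of_discrete).comp
        h.measurable_rxCount |>.mul
        ((measurable_one.indicator hS).comp (h.measurable_rx i))).aemeasurable
  simp_rw [hind]
  rw [← smul_eq_mul, ← lintegral_smul_measure, ← hmeas, lintegral_sum_measure]
  exact tsum_congr fun i => (lintegral_map hf (h.measurable_rx i)).symm

/-- The intensity measure does not charge the origin, so the exceptional location `z = 0` plays no
role for the receivers. -/
lemma ae_receiver_ne_zero (h : IsHighMobilityCluster P Q τ lamM lamR R x M y F) (i : ℕ) :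
    ∀ᵐ ω ∂P, i < M ω → y i ω ≠ 0 := by
  have h1 := h.tsum_lintegral_receiver (f := ({0} : Set Plane).indicator 1)
    (measurable_one.indicator (measurableSet_singleton 0))
  have h2 : ∫⁻ z in Metric.ball (0 : Plane) R, ({0} : Set Plane).indicator 1 z = 0 := by
    rw [lintegral_indicator_one (measurableSet_singleton 0)]
    exact le_antisymm ((Measure.restrict_apply_le _ _).trans (by simp)) zero_le
  rw [h2, mul_zero, ENNReal.tsum_eq_zero] at h1
  have hm : Measurable fun ω => (Set.Ioi i).indicator (1 : ℕ → ℝ≥0∞) (M ω) *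
      ({0} : Set Plane).indicator 1 (y i ω) :=
    ((measurable_one.indicator MeasurableSet.of_discrete).comp h.measurable_rxCount).mul
      ((measurable_one.indicator (measurableSet_singleton 0)).comp (h.measurable_rx i))
  filter_upwards [(lintegral_eq_zero_iff hm).1 (h1 i)] with ω hω hi hy
  simp [hi, hy] at hω

/-- Two successive averages with the receivers frozen: over the fading, then over the transmitters.
The second uses `rx_indep`, so the integrand must be a jointly measurable function of processes and
receivers. -/
lemma lintegral_receiver_covered [IsProbabilityMeasure P]
    (h : IsHighMobilityCluster P Q τ lamM lamR R x M y F) (hlamM : 0 < lamM) (hA : 0 < A)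
    (hα : 2 < α) (hT : 0 < T) (hb : 0 ≤ b)
    (hQ : IsPoissonPointProcessLaw Q (ENNReal.ofReal lamM • (volume : Measure Plane)))
    (i : ℕ) :
    P {ω | i < M ω ∧ Covered (pathLoss A α) b T (fun k j => x k j ω) (fun k j => F k i j ω)
        (y i ω)} =
      ∫⁻ ω, (Set.Ioi i).indicator 1 (M ω) *
        ENNReal.ofReal (1 - (1 - meanSlotCoverage lamM A α b T (y i ω)) ^ τ) ∂P := by
  have hα0 : 0 < α := by linarith
  have hne := h.ae_receiver_ne_zero i
  have hpm : ∀ k, Measurable (pointProcess (x k)) := fun k =>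
    measurable_pointProcess (h.measurable_tx k)
  have hfin : ∀ᵐ ω ∂P, ∀ k, locallyFiniteKernel (pointProcess (x k) ω) = pointProcess (x k) ω := by
    refine ae_all_iff.2 fun k => ?_
    filter_upwards [ae_all_iff.2 fun n : ℕ => (h.tx_palm k).ae_lt_top hlamM (hpm k) hQ n] with ω hω
    exact locallyFiniteKernel_apply hω
  have hsum := ae_all_iff.2 fun k => logLaplaceSum_ae_eq (T := T) hA hα0 h k
  let S : Plane → Measure Plane → ℝ≥0∞ := fun z φ =>
    ∫⁻ u, logLaplace A α (T * pathLoss A α ‖z‖) ‖u - z‖ ∂(locallyFiniteKernel φ) -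
      logLaplace A α (T * pathLoss A α ‖z‖) ‖z‖
  have hS : Measurable (Function.uncurry S) := by
    have hlog : ∀ {E : Type} [MeasurableSpace E] {s r : E → ℝ}, Measurable s → Measurable r →
        Measurable fun e => logLaplace A α (s e) (r e) := fun hs hr =>
      measurable_logOneAdd.comp (hs.ennreal_ofReal.div hr.pathLoss.ennreal_ofReal)
    refine Measurable.sub ?_ (hlog (by fun_prop) (by fun_prop))
    exact Measurable.lintegral_kernel_prod_right
      (κ := locallyFiniteKernel.comap Prod.snd measurable_snd)
      (f := fun (p : Plane × Measure Plane) u =>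
        logLaplace A α (T * pathLoss A α ‖p.1‖) ‖u - p.1‖)
      (hlog (by fun_prop) (by fun_prop))
  -- The conditional coverage probability as a function of the slot processes and the receivers.
  let G : (Fin τ → Measure Plane) → (ℕ × (ℕ → Plane)) → ℝ≥0∞ := fun φ p =>
    (Set.Ioi i).indicator 1 p.1 * (1 - ∏ k, (1 - slotCoverage A α b T (p.2 i) (S (p.2 i) (φ k))))
  have hG : Measurable (Function.uncurry G) := by
    refine Measurable.mul ((measurable_one.indicator MeasurableSet.of_discrete).comp (by fun_prop))
      (Measurable.const_sub (Finset.measurable_fun_prod _ fun k _ => Measurable.const_sub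
        (Measurable.slotCoverage (by fun_prop) ?_) _) _)
    exact hS.comp (f := fun q : (Fin τ → Measure Plane) × (ℕ × (ℕ → Plane)) =>
      (q.2.2 i, q.1 k)) (by fun_prop)
  have key := h.rx_indep.symm.lintegral_comp_prodMk (measurable_pi_iff.2 hpm)
    (h.measurable_rxCount.prodMk (measurable_pi_iff.2 h.measurable_rx)) hG
  refine (h.measure_covered_eq_lintegral (b := b) (T := T) (measurable_pathLoss (A := A) (α := α)) i
    (D := Set.Ioi i) (Z := fun y => y i) (measurable_pi_apply i)).trans ?_
  refine Eq.trans (lintegral_congr_ae ?_) (key.trans (lintegral_congr_ae ?_))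
  · filter_upwards [hne, hfin, hsum] with ω h1 h2 h3
    by_cases hi : i < M ω
    · simp only [G, S]
      congr 1
      rw [_root_.measure_covered hA hT (h.iIndepFun_fading_receiver i)
        (fun k j => h.measurable_fading k i j) (fun k j => h.fading_law k i j) _ (h1 hi)]
      simp_rw [h2, h3 _ _ (h1 hi)]
    · simp [G, hi]
  · filter_upwards [hne] with ω h1
    by_cases hi : i < M ω
    · rw [← lintegral_one_sub_prod_slotCoverage hlamM hA hα hT hb hQ h (h1 hi)]
      simp only [G, S, Set.indicator_of_mem (show M ω ∈ Set.Ioi i from hi), Pi.one_apply, one_mul]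
      refine lintegral_congr_ae ?_
      filter_upwards [hfin, hsum] with ω' h2 h3
      simp_rw [h2, h3 _ _ (h1 hi)]
    · simp [G, hi]

lemma natCast_numCovered {Ω : Type*} (ℓ : ℝ → ℝ) (x : Fin τ → ℕ → Ω → Plane) (M : Ω → ℕ)
    (y : ℕ → Ω → Plane) (F : Fin τ → ℕ → ℕ → Ω → ℝ) (ω : Ω) :
    (numCovered ℓ b T x M y F ω : ℝ≥0∞) = ∑' i, {ω | i < M ω ∧ Covered ℓ b T (fun k j => x k j ω)
      (fun k j => F k i j ω) (y i ω)}.indicator 1 ω := by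
  classical
  rw [numCovered, Finset.card_filter, Nat.cast_sum, tsum_eq_sum (s := Finset.range (M ω))]
  · refine Finset.sum_congr rfl fun i hi => ?_
    simp [Set.indicator_apply, Finset.mem_range.1 hi]
  · intro i hi
    simp [Finset.mem_range.not.1 hi]

lemma measurableSet_receiver_covered (h : IsHighMobilityCluster P Q τ lamM lamR R x M y F)
    {ℓ : ℝ → ℝ} (hℓ : Measurable ℓ) (i : ℕ) :
    MeasurableSet {ω | i < M ω ∧ Covered ℓ b T (fun k j => x k j ω)
      (fun k j => F k i j ω) (y i ω)} :=
  (h.measurable_rxCount (MeasurableSet.of_discrete (s := Set.Ioi i))).inter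
    (measurableSet_covered hℓ b T h.measurable_tx (fun k j => h.measurable_fading k i j)
      (h.measurable_rx i))

lemma measurable_numCovered (h : IsHighMobilityCluster P Q τ lamM lamR R x M y F)
    {ℓ : ℝ → ℝ} (hℓ : Measurable ℓ) :
    Measurable fun ω => (numCovered ℓ b T x M y F ω : ℝ≥0∞) := by
  simp_rw [natCast_numCovered]
  exact Measurable.tsum fun i =>
    measurable_one.indicator (h.measurableSet_receiver_covered hℓ i)

/-- Linearity of expectation and Campbell's formula; dependence between receivers does not matter.
-/
lemma lintegral_numCovered [IsProbabilityMeasure P]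
    (h : IsHighMobilityCluster P Q τ lamM lamR R x M y F) (hlamM : 0 < lamM) (hA : 0 < A)
    (hα : 2 < α) (hT : 0 < T) (hb : 0 ≤ b)
    (hQ : IsPoissonPointProcessLaw Q (ENNReal.ofReal lamM • (volume : Measure Plane))) :
    ∫⁻ ω, (numCovered (pathLoss A α) b T x M y F ω : ℝ≥0∞) ∂P = ENNReal.ofReal lamR *
      ∫⁻ z in Metric.ball 0 R, ENNReal.ofReal (1 - (1 - meanSlotCoverage lamM A α b T z) ^ τ) := by
  have hp : Measurable fun z => ENNReal.ofReal (1 - (1 - meanSlotCoverage lamM A α b T z) ^ τ) := by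
    unfold meanSlotCoverage; fun_prop
  have hcov := h.measurableSet_receiver_covered (b := b) (T := T)
    (measurable_pathLoss (A := A) (α := α))
  simp_rw [natCast_numCovered]
  rw [lintegral_tsum fun i => (measurable_one.indicator (hcov i)).aemeasurable,
    ← h.tsum_lintegral_receiver hp]
  refine tsum_congr fun i => ?_
  rw [lintegral_indicator_one (hcov i),
    h.lintegral_receiver_covered hlamM hA hα hT hb hQ i]

end IsHighMobilityCluster
end Receivers

/-! ### Binomial expansion, polar coordinates and the theorem. -/

lemma one_sub_one_sub_pow (q : ℝ) (τ : ℕ) :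
    1 - (1 - q) ^ τ = ∑ n ∈ Finset.Icc 1 τ, (-1 : ℝ) ^ (n + 1) * (τ.choose n : ℝ) * q ^ n := by
  have h := add_pow (-q) 1 τ
  rw [Finset.range_eq_Ico, Finset.sum_eq_sum_Ico_succ_bot (Nat.succ_pos τ)] at h
  rw [show 1 - q = -q + 1 by ring, h]
  simp only [pow_zero, one_pow, mul_one, Nat.choose_zero_right, Nat.cast_one, zero_add]
  -- The `n = 0` term cancels the leading `1`, so the sum starts at `1`.
  rw [sub_add_cancel_left, ← Finset.sum_neg_distrib]
  refine Finset.sum_congr (by ext; simp) fun n _ => ?_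
  rw [neg_pow]
  ring

lemma meanSlotCoverage_pow {lam A α b T : ℝ} (hA : 0 < A) (hα : 0 < α) (hT : 0 < T) (z : Plane)
    (n : ℕ) : meanSlotCoverage lam A α b T z ^ n =
      Real.exp (-(n * T * b * A * ‖z‖ ^ α)) *
        Real.exp (-(lam * (n * K α 1) * T ^ (2 / α) * ‖z‖ ^ 2)) := by
  have h : (T * pathLoss A α ‖z‖ / A) ^ (2 / α) = T ^ (2 / α) * ‖z‖ ^ 2 := by
    rw [pathLoss, mul_left_comm, mul_div_cancel_left₀ _ hA.ne', Real.mul_rpow hT.le (by positivity),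
      ← Real.rpow_mul (norm_nonneg z), mul_div_cancel₀ _ hα.ne', Real.rpow_two]
  rw [meanSlotCoverage, h, mul_pow, ← Real.exp_nat_mul, ← Real.exp_nat_mul, pathLoss]
  congr 2 <;> ring

lemma setIntegral_ball_fun_norm (f : ℝ → ℝ) {R : ℝ} (hR : 0 ≤ R) :
    ∫ z in Metric.ball (0 : Plane) R, f ‖z‖ = 2 * Real.pi * ∫ r in (0 : ℝ)..R, r * f r := by
  have h := integral_fun_norm_plane ((Set.Iio R).indicator f)
  have h1 : (fun z : Plane => (Set.Iio R).indicator f ‖z‖) =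
      (Metric.ball (0 : Plane) R).indicator fun z => f ‖z‖ := by
    classical
    ext z; simp [Set.indicator_apply]
  have h2 : (fun r => r * (Set.Iio R).indicator f r) = (Set.Iio R).indicator fun r => r * f r := by
    ext r; simp [Set.indicator_apply]
  rw [h1, h2, integral_indicator measurableSet_ball, setIntegral_indicator measurableSet_Iio,
    Set.Ioi_inter_Iio, ← integral_Ioc_eq_integral_Ioo,
    ← intervalIntegral.integral_of_le hR] at h
  exact h

theorem proposition3 {Ω : Type*} [MeasurableSpace Ω] (P : Measure Ω) [IsProbabilityMeasure P]
    (τ : ℕ) (lamM lamR R A α T σ2 Pm : ℝ)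
    (hlamM : 0 < lamM) (hlamR : 0 ≤ lamR) (hR : 0 < R) (hA : 0 < A) (hα : 2 < α) (hT : 0 < T)
    (hσ2 : 0 ≤ σ2) (hPm : 0 < Pm)
    (Q : Measure (Measure Plane))
    (hQ : IsPoissonPointProcessLaw Q (ENNReal.ofReal lamM • (volume : Measure Plane)))
    (x : Fin τ → ℕ → Ω → Plane) (M : Ω → ℕ) (y : ℕ → Ω → Plane) (F : Fin τ → ℕ → ℕ → Ω → ℝ)
    (hmodel : IsHighMobilityCluster P Q τ lamM lamR R x M y F) :
    (∀ (i : ℕ) (z : Plane),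
      coverageProb P (pathLoss A α) (σ2 / Pm) T x F i z =
        ∑ n ∈ Finset.Icc 1 τ, (-1 : ℝ) ^ (n + 1) * (τ.choose n : ℝ) *
          Real.exp (-(n * T * (σ2 / Pm) * A * ‖z‖ ^ α)) *
          Real.exp (-(lamM * (n * K α 1) * T ^ (2 / α) * ‖z‖ ^ 2))) ∧
    Integrable (fun ω => (numCovered (pathLoss A α) (σ2 / Pm) T x M y F ω : ℝ)) P ∧
    ∫ ω, (numCovered (pathLoss A α) (σ2 / Pm) T x M y F ω : ℝ) ∂P =
      2 * Real.pi * lamR * ∑ n ∈ Finset.Icc 1 τ, (-1 : ℝ) ^ (n + 1) * (τ.choose n : ℝ) *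
        ∫ r in (0 : ℝ)..R, r * Real.exp (-(n * T * (σ2 / Pm) * A * r ^ α)) *
          Real.exp (-(lamM * (n * K α 1) * T ^ (2 / α) * r ^ 2)) := by
  have hα0 : 0 < α := by linarith
  have hb : 0 ≤ σ2 / Pm := by positivity
  set b := σ2 / Pm
  have hq0 : ∀ z, 0 ≤ 1 - meanSlotCoverage lamM A α b T z := fun z =>
    sub_nonneg.2 (meanSlotCoverage_le_one hlamM.le hA hα0 hT hb z)
  have hp0 : ∀ z, 0 ≤ 1 - (1 - meanSlotCoverage lamM A α b T z) ^ τ := fun z =>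
    sub_nonneg.2 (pow_le_one₀ (hq0 z)
      (sub_le_self _ (meanSlotCoverage_nonneg lamM A α b T z)))
  have hexp : ∀ z : Plane, 1 - (1 - meanSlotCoverage lamM A α b T z) ^ τ =
      ∑ n ∈ Finset.Icc 1 τ, (-1 : ℝ) ^ (n + 1) * (τ.choose n : ℝ) *
          Real.exp (-(n * T * b * A * ‖z‖ ^ α)) *
          Real.exp (-(lamM * (n * K α 1) * T ^ (2 / α) * ‖z‖ ^ 2)) := by
    intro z
    simp_rw [one_sub_one_sub_pow, meanSlotCoverage_pow hA hα0 hT, mul_assoc]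
  have hmean := hmodel.lintegral_numCovered hlamM hA hα hT hb hQ
  have hpm : Measurable fun z => 1 - (1 - meanSlotCoverage lamM A α b T z) ^ τ := by
    unfold meanSlotCoverage; fun_prop
  -- The coverage probability is at most `1` and the disc has finite area; this yields integrability
  -- of `N`.
  have hfin : ∫⁻ z in Metric.ball (0 : Plane) R,
      ENNReal.ofReal (1 - (1 - meanSlotCoverage lamM A α b T z) ^ τ) ≠ ∞ := by
    refine ne_top_of_le_ne_top (b := volume (Metric.ball (0 : Plane) R))
      measure_ball_lt_top.ne ?_
    rw [← setLIntegral_one]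
    refine lintegral_mono fun z => ENNReal.ofReal_le_one.2 ?_
    exact sub_le_self _ (pow_nonneg (hq0 z) _)
  have hNm := hmodel.measurable_numCovered (b := b) (T := T) (measurable_pathLoss (A := A) (α := α))
  have htop : ∫⁻ ω, (numCovered (pathLoss A α) b T x M y F ω : ℝ≥0∞) ∂P ≠ ∞ := by
    rw [hmean]; finiteness
  refine ⟨fun i z => ?_, ?_, ?_⟩
  · rw [coverageProb, Measure.real, hmodel.measure_covered hlamM hA hα hT hb hQ i z,
      ENNReal.toReal_ofReal (hp0 z), hexp]
  · simpa using integrable_toReal_of_lintegral_ne_top hNm.aemeasurable htop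
  · have h1 := integral_toReal hNm.aemeasurable (ae_lt_top hNm htop)
    simp only [ENNReal.toReal_natCast] at h1
    rw [h1, hmean, ENNReal.toReal_mul, ENNReal.toReal_ofReal hlamR,
      ← integral_eq_lintegral_of_nonneg_ae (ae_of_all _ hp0) hpm.aestronglyMeasurable]
    simp_rw [hexp]
    rw [setIntegral_ball_fun_norm (fun r => ∑ n ∈ Finset.Icc 1 τ,
      (-1 : ℝ) ^ (n + 1) * (τ.choose n : ℝ) * Real.exp (-(n * T * b * A * r ^ α)) *
        Real.exp (-(lamM * (n * K α 1) * T ^ (2 / α) * r ^ 2))) hR.le, ← mul_assoc,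
      mul_comm lamR]
    congr 1
    have hrpow : Continuous fun r : ℝ => r ^ α := Real.continuous_rpow_const hα0.le
    simp_rw [Finset.mul_sum, ← intervalIntegral.integral_const_mul]
    rw [intervalIntegral.integral_finsetSum fun n _ =>
      Continuous.intervalIntegrable (by fun_prop) _ _]
    refine Finset.sum_congr rfl fun n _ => intervalIntegral.integral_congr fun r _ => ?_
    ring
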